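/- **Conventions.** For $P\in\mathbb{C}[T]$ and $j\ge 0$ let $P^{[j]}=\frac1{j!}\frac{d^jP}{dT^j}$. For a non-zero $P\in\mathbb{Z}[T]$ let $\mathrm{cont}(P)$ be the gcd of its coefficients and let the height $H(P)$ be the maximum of the absolute values of its coefficients divided by $\mathrm{cont}(P)$. A *cyclotomic* polynomial is a monic polynomial of $\mathbb{Z}[T]$ all of whose complex roots are roots of unity. For a non-empty finite set $E\subset\mathbb{C}$ let $\Delta_E=\prod_{\xi\ne\xi'}|\xi'-\xi|^{1/2}$, the product being over all ordered pairs $(\xi,\xi')$ of distinct elements of $E$ (so $\Delta_E=1$ if $E$ has one point), and let $|E|$ be the cardinality of $E$. **Proposition 3.1.** Let $M,n,t$ be positive integers with $1\le t\le n$ and let $X\in\mathbb{R}$. Let $A$ be a non-empty subset of $\{1,2,\dots,M\}$, and let $E$ be a non-empty finite set of non-zero complex numbers, none of which is a root of unity. Let $P\in\mathbb{Z}[T]$ be a non-zero polynomial with $\deg(P)\le n$ and $H(P)\le X$, written as a product $P(T)=P_0(T)\,T^r\,\Phi(T)^t$ where $P_0\in\mathbb{Z}[T]$, $r\ge 0$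 is an integer, and $\Phi\in\mathbb{Z}[T]$ is cyclotomic. Put $$c_E=\max\{\max(|\xi|,|\xi|^{-1})\,:\,\xi\in E\},$$ $$\delta_\Phi=\min\{|\Phi(\xi^a)|\,:\,a\in A,\ \xi\in E\},$$ $$\delta_P=\max\{|P^{[j]}(\xi^a)|\,:\,a\in A,\ \xi\in E,\ 0\le j<2t-1\},$$ and assume that $$t|E|\le Mn\le\tfrac1{10}\log X\qquad\text{and}\qquad(2+c_E)^{20t|E|}\le X.$$ Let $Q\in\mathbb{Z}[T]$ be a greatest common divisor, in $\mathbb{Z}[T]$, of the polynomials $P_0^{[j]}(T^a)$ with $a\in A$ and $0\le j<t$. Then $$\prod_{\xi\in E}\frac{|Q(\xi)|}{\mathrm{cont}(Q)}\le X^{5Mn/t}\,\Delta_E^{-t}\left(\frac{\delta_P}{\min(1,\delta_\Phi)^{3t}}\right)^{|E|}.$$ -/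

import Mathlib

open Polynomial

/-- The height of a (non-zero) polynomial of `ℤ[X]`: the maximum of the absolute values of its
coefficients, divided by its content. -/
noncomputable def intHeight (P : ℤ[X]) : ℝ :=
  P.supNorm / (P.content : ℝ)

/-- A cyclotomic polynomial in the broad sense: a monic polynomial of `ℤ[X]` (possibly `1`, possibly
with multiple roots) all of whose complex roots are roots of unity. -/
def IsCyclotomicPoly (Φ : ℤ[X]) : Prop :=
  Φ.Monic ∧ ∀ z : ℂ, aeval z Φ = 0 → IsOfFinOrder z

/-- `Q` is a greatest common divisor in `ℤ[X]` of the family of polynomials in `S`. -/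
def IsPolyGCD (S : Set ℤ[X]) (Q : ℤ[X]) : Prop :=
  (∀ F ∈ S, Q ∣ F) ∧ ∀ D : ℤ[X], (∀ F ∈ S, D ∣ F) → D ∣ Q

/-- `Δ_E`: the product of `|ξ' - ξ|^(1/2)` over all ordered pairs of distinct elements of `E`;
it is `1` if `E` consists of one point. -/
noncomputable def bigDelta (E : Finset ℂ) : ℝ :=
  ∏ p ∈ E.offDiag, ‖p.2 - p.1‖ ^ (1 / 2 : ℝ)

/-- `c_E`: the maximum of `max (|ξ|, |ξ|⁻¹)` over `ξ ∈ E`. -/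
noncomputable def constE (E : Finset ℂ) (hE : E.Nonempty) : ℝ :=
  E.sup' hE fun ξ => max ‖ξ‖ ‖ξ‖⁻¹

/-- `δ_Φ`: the minimum of `|Φ(ξ^a)|` over `a ∈ A` and `ξ ∈ E`. -/
noncomputable def deltaPhi (Φ : ℤ[X]) (A : Finset ℕ) (hA : A.Nonempty)
    (E : Finset ℂ) (hE : E.Nonempty) : ℝ :=
  A.inf' hA fun a => E.inf' hE fun ξ => ‖aeval (ξ ^ a) Φ‖

/-- `δ_P`: the maximum of `|P^{[j]}(ξ^a)|` over `a ∈ A`, `ξ ∈ E` and `0 ≤ j < 2t - 1`, where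
`P^{[j]} = hasseDeriv j P` is the `j`-th divided derivative of `P`. -/
noncomputable def deltaP (P : ℤ[X]) (t : ℕ) (ht : 1 ≤ t) (A : Finset ℕ) (hA : A.Nonempty)
    (E : Finset ℂ) (hE : E.Nonempty) : ℝ :=
  A.sup' hA fun a => E.sup' hE fun ξ =>
    (Finset.range (2 * t - 1)).sup' (Finset.nonempty_range_iff.mpr (by omega)) fun j =>
      ‖aeval (ξ ^ a) (hasseDeriv j P)‖

/-!
The inequality is proved after raising it to the power `t`. Let `N = M * n`, `s = |E|`, and assume
that `P₀` and `Q` are primitive. The polynomials `F = P₀^{[j]}(X ^ a)` have degree at most `N`, and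
their shifts `X ^ i * F` of degree `< 2N` span over `ℚ` all the multiples of `Q` of degree `< 2N`
(`mem_span_shifts`). So `K = 2N - deg Q` of these shifts can be written `Q * G k`, where the `G k`
are integer polynomials of degree `< K` with a nonzero, hence at least `1` in absolute value,
determinant of coefficients (`exists_shifts_det_ne_zero`).

Apply to the `Q * G k` the following `K` linear forms: the divided derivatives of order `< t` at the
points of `E`, which number `s * t ≤ N ≤ K`, and the `K - s * t` highest coefficients. In the basis
of the products of `Q` by Newton polynomials these forms have a block triangular matrix, with
determinant equal, in absolute value, to `∏ |Q(ξ)| ^ t * bigDelta E ^ (t * t)` times a power of the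
leading coefficient of `Q` (`det_hermiteForm_newtonPoly`). Hence `∏ |Q(ξ)| ^ t * bigDelta E ^ (t * t)`
is at most the absolute value of the determinant of the values of the forms at the `Q * G k`, which
is estimated by bounding its rows (`prod_norm_eval_pow_mul_le`).

The coefficient rows are at most `8 ^ n * X`, because `X ^ r * Φ ^ t` has Mahler measure `1`
(`norm_coeff_cofactor_le`). The rows of derivatives involve the divided derivatives of `P₀` of order
at most `2t - 2` at the points `ξ ^ a`. They are derived from those of `P` by dividing the Taylor
expansion of `P` by that of `X ^ r * Φ ^ t`, with respect to an `ℓ¹` norm on a disc of radius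
comparable to `min 1 δ_Φ` (`norm_coeff_taylor_cofactor_le`); this costs the factor
`min 1 δ_Φ ^ (-3t)`.
-/

/-! ### Multiples of a greatest common divisor as combinations of shifts -/

theorem mul_mem_span_shifts {k : Type*} [Field k] (F r : k[X]) (L : ℕ)
    (h : (r * F).degree < L) :
    r * F ∈ Submodule.span k {v | ∃ i < L, v = X ^ i * F ∧ v.degree < (L : WithBot ℕ)} := by
  by_cases hF : F = 0
  · simp [hF]
  have hsum : r * F = ∑ i ∈ r.support, C (r.coeff i) * X ^ i * F := by
    rw [← Finset.sum_mul, ← r.as_sum_support_C_mul_X_pow]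
  rw [hsum]
  refine Submodule.sum_mem _ fun i hi => ?_
  rw [mul_assoc, ← smul_eq_C_mul]
  refine Submodule.smul_mem _ _ (Submodule.subset_span ?_)
  have hr : r ≠ 0 := by rintro rfl; simp at hi
  have hi' : i ≤ r.natDegree := le_natDegree_of_mem_supp i hi
  have hd : r.natDegree + F.natDegree < L := by
    rwa [← natDegree_mul hr hF, natDegree_lt_iff_degree_lt (mul_ne_zero hr hF)]
  refine ⟨i, by omega, rfl, ?_⟩
  rw [← natDegree_lt_iff_degree_lt (mul_ne_zero (pow_ne_zero _ X_ne_zero) hF),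
    natDegree_mul (pow_ne_zero _ X_ne_zero) hF, natDegree_X_pow]
  omega

/-- An element of degree `< 2N` of the ideal generated by polynomials `F i` of degree at most `N`
is a linear combination of shifts `X ^ j * F i` that are themselves of degree `< 2N`: the cofactors
may be reduced modulo one nonzero generator. -/
theorem mem_span_shifts {k : Type*} [Field k] {ι : Type*} [Fintype ι] (F : ι → k[X]) (N : ℕ)
    (hN : ∀ i, (F i).natDegree ≤ N) (h0 : ∃ i, F i ≠ 0) (g : k[X])
    (hg : g ∈ Ideal.span (Set.range F)) (hd : g.degree < (2 * N : ℕ)) :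
    g ∈ Submodule.span k {v | ∃ i, ∃ j < 2 * N, v = X ^ j * F i ∧
      v.degree < ((2 * N : ℕ) : WithBot ℕ)} := by
  obtain ⟨i₀, hi₀⟩ := h0
  obtain ⟨c, hc⟩ := Ideal.mem_span_range_iff_exists_fun.1 hg
  have key : ∀ (i : ι) (r : k[X]), (r * F i).degree < (2 * N : ℕ) →
      r * F i ∈ Submodule.span k
        {v | ∃ i, ∃ j < 2 * N, v = X ^ j * F i ∧
      v.degree < ((2 * N : ℕ) : WithBot ℕ)} := by
    intro i r h
    refine Submodule.span_mono ?_ (mul_mem_span_shifts (F i) r (2 * N) h)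
    rintro v ⟨j, hj, rfl, hv⟩
    exact ⟨i, j, hj, rfl, hv⟩
  have hdeg : ∀ i, (c i % F i₀ * F i).degree < (2 * N : ℕ) := by
    intro i
    by_cases h1 : c i % F i₀ = 0
    · rw [h1, zero_mul, degree_zero]; exact WithBot.bot_lt_coe _
    by_cases h2 : F i = 0
    · rw [h2, mul_zero, degree_zero]; exact WithBot.bot_lt_coe _
    rw [← natDegree_lt_iff_degree_lt (mul_ne_zero h1 h2), natDegree_mul h1 h2]
    have h3 : (c i % F i₀).natDegree < (F i₀).natDegree :=
      natDegree_lt_natDegree h1 (EuclideanDomain.mod_lt (c i) hi₀)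
    have := hN i
    have := hN i₀
    omega
  have hsum : g = ∑ i, c i % F i₀ * F i + (∑ i, c i / F i₀ * F i) * F i₀ := by
    rw [← hc, Finset.sum_mul, ← Finset.sum_add_distrib]
    refine Finset.sum_congr rfl fun i _ => ?_
    conv_lhs => rw [← EuclideanDomain.mod_add_div (c i) (F i₀)]
    ring
  have hsd : (∑ i, c i % F i₀ * F i).degree < (2 * N : ℕ) :=
    (degree_sum_le _ _).trans_lt
      ((Finset.sup_lt_iff (WithBot.bot_lt_coe _)).2 fun i _ => hdeg i)
  have hrest : ((∑ i, c i / F i₀ * F i) * F i₀).degree < (2 * N : ℕ) := by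
    rw [← sub_eq_iff_eq_add'.2 hsum]
    exact (degree_sub_le _ _).trans_lt (max_lt hd hsd)
  have := Submodule.add_mem _ (Submodule.sum_mem _ fun i (_ : i ∈ Finset.univ) => key i _ (hdeg i))
    (key i₀ _ hrest)
  rwa [← hsum] at this

/-- If every primitive common divisor in `ℤ[X]` of the `F i` divides `Q`, then `Q` belongs to the
ideal they generate over `ℚ`. -/
theorem map_mem_span_of_forall_isPrimitive_dvd {ι : Type*} (F : ι → ℤ[X]) (Q : ℤ[X])
    (h0 : ∃ i, F i ≠ 0)
    (hQ : ∀ D : ℤ[X], D.IsPrimitive → (∀ i, D ∣ F i) → D ∣ Q) :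
    Q.map (Int.castRingHom ℚ) ∈
      Ideal.span (Set.range fun i => (F i).map (Int.castRingHom ℚ)) := by
  set I := Ideal.span (Set.range fun i => (F i).map (Int.castRingHom ℚ)) with hI
  obtain ⟨g, hg⟩ := (IsPrincipalIdealRing.principal I).principal
  have hg' : I = Ideal.span {g} := hg
  have hdvd : ∀ i, g ∣ (F i).map (Int.castRingHom ℚ) := fun i => by
    rw [← Ideal.mem_span_singleton, ← hg']
    exact Ideal.subset_span ⟨i, rfl⟩
  have hg0 : g ≠ 0 := by
    rintro rfl
    obtain ⟨i, hi⟩ := h0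
    exact hi ((Polynomial.map_eq_zero_iff (RingHom.injective_int _)).1
      (zero_dvd_iff.1 (hdvd i)))
  -- clear the denominators of the generator `g` and take the primitive part
  obtain ⟨b, hb, hbg⟩ := IsLocalization.integerNormalization_spec (nonZeroDivisors ℤ) g
  set G := IsLocalization.integerNormalization (nonZeroDivisors ℤ) g
  have hb0 : (b : ℚ) ≠ 0 := by exact_mod_cast nonZeroDivisors.ne_zero hb
  have hbg' : G.map (Int.castRingHom ℚ) = C (b : ℚ) * g := by
    rw [← smul_eq_C_mul]
    have : (b : ℚ) • g = b • g := by
      rw [← algebraMap_smul ℚ b g]; rfl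
    rw [this, ← hbg]; rfl
  have hG0 : G ≠ 0 := by
    intro h
    rw [h, Polynomial.map_zero] at hbg'
    exact mul_ne_zero (C_ne_zero.2 hb0) hg0 hbg'.symm
  have hassoc : C (G.content : ℚ) * G.primPart.map (Int.castRingHom ℚ) = C (b : ℚ) * g := by
    rw [← hbg']
    conv_rhs => rw [G.eq_C_content_mul_primPart]
    simp
  have hc0 : (G.content : ℚ) ≠ 0 := by exact_mod_cast mt content_eq_zero_iff.1 hG0
  have hpg : G.primPart.map (Int.castRingHom ℚ) ∣ g := by
    rw [← (isUnit_C.2 (isUnit_iff_ne_zero.2 hb0)).dvd_mul_left, ← hassoc]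
    exact dvd_mul_left _ _
  have hgp : g ∣ G.primPart.map (Int.castRingHom ℚ) := by
    rw [← (isUnit_C.2 (isUnit_iff_ne_zero.2 hc0)).dvd_mul_left, hassoc]
    exact dvd_mul_left _ _
  have hD : G.primPart ∣ Q := hQ _ G.isPrimitive_primPart fun i =>
    (IsPrimitive.Int.dvd_iff_map_cast_dvd_map_cast _ _ G.isPrimitive_primPart).2
      (hpg.trans (hdvd i))
  rw [hg', Ideal.mem_span_singleton]
  exact hgp.trans (Polynomial.map_dvd _ hD)

/-- If the integer polynomials in `S` span, over `ℚ`, all the polynomials of degree `< K`, then some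
`K` of them have an invertible matrix of coefficients in degrees `< K`. -/
theorem exists_det_coeff_ne_zero (S : Set ℤ[X]) (K : ℕ)
    (hS : ∀ g : ℚ[X], g.degree < K →
      g ∈ Submodule.span ℚ (Polynomial.map (Int.castRingHom ℚ) '' S)) :
    ∃ G : Fin K → ℤ[X], (∀ i, G i ∈ S) ∧
      (Matrix.of fun (l i : Fin K) => (G l).coeff i).det ≠ 0 := by
  let φ : ℚ[X] →ₗ[ℚ] (Fin K → ℚ) := LinearMap.pi fun i => Polynomial.lcoeff ℚ i
  have htop : Submodule.span ℚ (φ '' (Polynomial.map (Int.castRingHom ℚ) '' S)) = ⊤ := by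
    rw [Submodule.span_image, eq_top_iff]
    rintro v -
    refine ⟨∑ i : Fin K, C (v i) * X ^ (i : ℕ), hS _ ?_, ?_⟩
    · refine (degree_sum_le _ _).trans_lt ((Finset.sup_lt_iff (WithBot.bot_lt_coe _)).2 ?_)
      intro i _
      exact (degree_C_mul_X_pow_le _ _).trans_lt (by exact_mod_cast i.2)
    · ext i
      simp [φ, coeff_X_pow, Fin.val_inj]
  have hfin : Module.finrank ℚ
      (Submodule.span ℚ (φ '' (Polynomial.map (Int.castRingHom ℚ) '' S))) = K := by
    rw [htop]; simp
  obtain ⟨f, hf, -, hli⟩ :=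
    Submodule.exists_fun_fin_finrank_span_eq ℚ (φ '' (Polynomial.map (Int.castRingHom ℚ) '' S))
  choose G hGS hG using fun i : Fin K => by simpa using hf (finCongr hfin.symm i)
  refine ⟨G, hGS, ?_⟩
  have hli' := hli.comp _ (finCongr hfin.symm).injective
  have hrow : (Matrix.of fun (l i : Fin K) => ((G l).coeff i : ℚ)).row =
      f ∘ finCongr hfin.symm := by
    funext l i
    have := congrFun (hG l) i
    simpa [φ] using this
  have hu : IsUnit (Matrix.of fun (l i : Fin K) => ((G l).coeff i : ℚ)) :=
    Matrix.linearIndependent_rows_iff_isUnit.1 (by rw [hrow]; exact hli')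
  have hdet := ((Matrix.isUnit_iff_isUnit_det _).1 hu).ne_zero
  intro h
  apply hdet
  have hmap : (Matrix.of fun (l i : Fin K) => ((G l).coeff i : ℚ)) =
      (Int.castRingHom ℚ).mapMatrix (Matrix.of fun (l i : Fin K) => (G l).coeff i) := by
    ext l i; simp
  rw [hmap, ← RingHom.map_det, h, map_zero]

/-- Let `Q` be a common divisor of the `F i`, all of degree at most `N`, such that every primitive
common divisor divides `Q`. The shifts
`X ^ j * F i` of degree `< 2N`, divided by `Q`, contain `2N - deg Q` polynomials which are linearly
independent, that is, whose coefficient matrix is invertible over `ℚ`. -/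
theorem exists_shifts_det_ne_zero {ι : Type*} [Fintype ι] (F : ι → ℤ[X]) (N : ℕ) (Q : ℤ[X])
    (hN : ∀ i, (F i).natDegree ≤ N) (h0 : ∃ i, F i ≠ 0) (hdvd : ∀ i, Q ∣ F i)
    (hQ : ∀ D : ℤ[X], D.IsPrimitive → (∀ i, D ∣ F i) → D ∣ Q) :
    ∃ G : Fin (2 * N - Q.natDegree) → ℤ[X],
      (∀ l, ∃ i, ∃ j < 2 * N, Q * G l = X ^ j * F i ∧ (G l).degree < (2 * N - Q.natDegree : ℕ)) ∧
      (Matrix.of fun (l i : Fin (2 * N - Q.natDegree)) => (G l).coeff i).det ≠ 0 := by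
  have hQ0 : Q ≠ 0 := by
    rintro rfl
    obtain ⟨i, hi⟩ := h0
    exact hi (zero_dvd_iff.1 (hdvd i))
  have hinj : Function.Injective (Int.castRingHom ℚ) := RingHom.injective_int _
  set Qr := Q.map (Int.castRingHom ℚ) with hQr
  have hQr0 : Qr ≠ 0 := (Polynomial.map_ne_zero_iff hinj).2 hQ0
  have hQrd : Qr.natDegree = Q.natDegree := natDegree_map_eq_of_injective hinj Q
  have hmem := map_mem_span_of_forall_isPrimitive_dvd F Q h0 hQ
  have hQN : Q.natDegree ≤ N := by
    obtain ⟨i, hi⟩ := h0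
    exact (natDegree_le_of_dvd (hdvd i) hi).trans (hN i)
  refine exists_det_coeff_ne_zero
    {G | ∃ i, ∃ j < 2 * N, Q * G = X ^ j * F i ∧ G.degree < (2 * N - Q.natDegree : ℕ)} _ ?_
  intro g hg
  have hspan := mem_span_shifts (fun i => (F i).map (Int.castRingHom ℚ)) N
    (fun i => natDegree_map_le.trans (hN i))
    (by obtain ⟨i, hi⟩ := h0; exact ⟨i, (Polynomial.map_ne_zero_iff hinj).2 hi⟩)
    (Qr * g) (Ideal.mul_mem_right _ _ hmem) (by
      by_cases hg0 : g = 0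
      · rw [hg0, mul_zero, degree_zero]; exact WithBot.bot_lt_coe _
      rw [← natDegree_lt_iff_degree_lt hg0] at hg
      rw [← natDegree_lt_iff_degree_lt (mul_ne_zero hQr0 hg0), natDegree_mul hQr0 hg0, hQrd]
      omega)
  have hsub : {v : ℚ[X] | ∃ i, ∃ j < 2 * N, v = X ^ j * (F i).map (Int.castRingHom ℚ) ∧
        v.degree < ((2 * N : ℕ) : WithBot ℕ)} ⊆
      LinearMap.mulLeft ℚ Qr '' (Polynomial.map (Int.castRingHom ℚ) ''
        {G | ∃ i, ∃ j < 2 * N, Q * G = X ^ j * F i ∧ G.degree < (2 * N - Q.natDegree : ℕ)}) := by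
    rintro v ⟨i, j, hj, rfl, hv⟩
    obtain ⟨G, hG⟩ := (hdvd i).mul_left (X ^ j)
    have hmap : X ^ j * (F i).map (Int.castRingHom ℚ) = Qr * G.map (Int.castRingHom ℚ) := by
      rw [hQr, ← Polynomial.map_mul, ← hG]; simp
    refine ⟨_, ⟨G, ⟨i, j, hj, hG.symm, ?_⟩, rfl⟩, hmap.symm⟩
    by_cases hG0 : G = 0
    · rw [hG0, degree_zero]; exact WithBot.bot_lt_coe _
    have hG0' : G.map (Int.castRingHom ℚ) ≠ 0 := (Polynomial.map_ne_zero_iff hinj).2 hG0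
    rw [hmap, ← natDegree_lt_iff_degree_lt (mul_ne_zero hQr0 hG0'), natDegree_mul hQr0 hG0',
      hQrd, natDegree_map_eq_of_injective hinj] at hv
    rw [← natDegree_lt_iff_degree_lt hG0]
    omega
  have h2 := Submodule.span_mono (R := ℚ) hsub hspan
  rw [Submodule.span_image] at h2
  obtain ⟨g', hg', hgg⟩ := h2
  rwa [← mul_left_cancel₀ hQr0 hgg]

/-! ### A confluent Vandermonde determinant -/

theorem norm_det_le_factorial_mul_prod {ι : Type*} [Fintype ι] [DecidableEq ι]
    (A : Matrix ι ι ℂ) (ρ : ι → ℝ) (h : ∀ i k, ‖A i k‖ ≤ ρ i) :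
    ‖A.det‖ ≤ (Fintype.card ι).factorial * ∏ i, ρ i := by
  rw [← A.det_transpose, Matrix.det_apply]
  refine (norm_sum_le _ _).trans ?_
  have : ∀ σ ∈ (Finset.univ : Finset (Equiv.Perm ι)),
      ‖Equiv.Perm.sign σ • ∏ i, A.transpose (σ i) i‖ ≤ ∏ i, ρ i := by
    intro σ _
    have h1 : ‖Equiv.Perm.sign σ • ∏ i, A.transpose (σ i) i‖ = ∏ i, ‖A i (σ i)‖ := by
      rcases Int.units_eq_one_or (Equiv.Perm.sign σ) with h | h <;> simp [h]
    rw [h1]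
    exact Finset.prod_le_prod (fun _ _ => norm_nonneg _) fun i _ => h _ _
  refine (Finset.sum_le_card_nsmul _ _ _ this).trans ?_
  rw [nsmul_eq_mul, Finset.card_univ, Fintype.card_perm]

theorem hasseDeriv_map_intCast (P : ℤ[X]) (j : ℕ) :
    hasseDeriv j (P.map (Int.castRingHom ℂ)) = (hasseDeriv j P).map (Int.castRingHom ℂ) := by
  ext i
  simp [hasseDeriv_coeff]

theorem coeff_taylor_map_intCast (P : ℤ[X]) (j : ℕ) (z : ℂ) :
    (taylor z (P.map (Int.castRingHom ℂ))).coeff j = aeval z (hasseDeriv j P) := by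
  rw [taylor_coeff, aeval_def, eval₂_eq_eval_map, hasseDeriv_map_intCast]
  rfl

section Confluent

variable {s t p : ℕ}

/-- The Newton-type basis attached to nodes `x b`, each repeated `t` times, and completed by
multiples of `∏ b, (X - x b) ^ t`. All its members are monic, one in each degree `< s * t + p`. -/
noncomputable def newtonPoly (x : Fin s → ℂ) : (Fin s ×ₗ Fin t) ⊕ Fin p → ℂ[X]
  | .inl q => (∏ b ∈ Finset.Iio (ofLex q).1, (X - C (x b)) ^ t) *
      (X - C (x (ofLex q).1)) ^ ((ofLex q).2 : ℕ)
  | .inr i => (∏ b, (X - C (x b)) ^ t) * X ^ (i : ℕ)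

/-- The linear forms evaluating the divided derivatives of order `< t` at the nodes `x b`, completed
by the coefficients of degree `d + s * t + i`. -/
noncomputable def hermiteForm (x : Fin s → ℂ) (d : ℕ) :
    (Fin s ×ₗ Fin t) ⊕ Fin p → ℂ[X] →ₗ[ℂ] ℂ
  | .inl q => (lcoeff ℂ (ofLex q).2).comp (taylor (x (ofLex q).1))
  | .inr i => lcoeff ℂ (d + s * t + i)

/-- The degree of the members of `newtonPoly`, as an enumeration of the index type. -/
def newtonIndex : (Fin s ×ₗ Fin t) ⊕ Fin p ≃ Fin (s * t + p) :=
  ((ofLex.trans finProdFinEquiv).sumCongr (Equiv.refl _)).trans finSumFinEquiv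

theorem newtonPoly_monic (x : Fin s → ℂ) (k : (Fin s ×ₗ Fin t) ⊕ Fin p) :
    (newtonPoly x k).Monic := by
  rcases k with q | i
  · exact (monic_prod_of_monic _ _ fun b _ => (monic_X_sub_C _).pow _).mul
      ((monic_X_sub_C _).pow _)
  · exact (monic_prod_of_monic _ _ fun b _ => (monic_X_sub_C _).pow _).mul (monic_X_pow _)

theorem natDegree_newtonPoly (x : Fin s → ℂ) (k : (Fin s ×ₗ Fin t) ⊕ Fin p) :
    (newtonPoly x k).natDegree = newtonIndex k := by
  have h : ∀ S : Finset (Fin s), (∏ b ∈ S, (X - C (x b)) ^ t).natDegree = S.card * t := by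
    intro S
    rw [natDegree_prod_of_monic _ _ fun b _ => (monic_X_sub_C _).pow _]
    simp
  have hm : ∀ S : Finset (Fin s), (∏ b ∈ S, (X - C (x b)) ^ t).Monic := fun S =>
    monic_prod_of_monic _ _ fun b _ => (monic_X_sub_C _).pow _
  rcases k with q | i
  · rw [newtonPoly, (hm _).natDegree_mul ((monic_X_sub_C _).pow _), h]
    simp [newtonIndex, mul_comm, add_comm]
  · rw [newtonPoly, (hm _).natDegree_mul (monic_X_pow _), h]
    simp [newtonIndex]

theorem taylor_X_sub_C_self (z : ℂ) : taylor z (X - C z) = X := by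
  simp

theorem hermiteForm_newtonPoly_of_lt (x : Fin s → ℂ) (d : ℕ) (Q : ℂ[X]) (q r : Fin s ×ₗ Fin t)
    (h : q < r) :
    hermiteForm (p := p) x d (.inl q) (Q * newtonPoly (p := p) x (.inl r)) = 0 := by
  change (taylor (x (ofLex q).1) (Q * ((∏ b ∈ Finset.Iio (ofLex r).1, (X - C (x b)) ^ t) *
      (X - C (x (ofLex r).1)) ^ ((ofLex r).2 : ℕ)))).coeff (ofLex q).2 = 0
  rcases Prod.Lex.lt_iff.1 h with h1 | ⟨h1, h2⟩
  · have : X ^ t ∣ taylor (x (ofLex q).1) (Q * ((∏ b ∈ Finset.Iio (ofLex r).1, (X - C (x b)) ^ t) *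
      (X - C (x (ofLex r).1)) ^ ((ofLex r).2 : ℕ))) := by
      rw [taylor_mul, taylor_mul]
      refine Dvd.dvd.mul_left (Dvd.dvd.mul_right ?_ _) _
      rw [← Finset.mul_prod_erase _ _ (Finset.mem_Iio.2 h1), taylor_mul, taylor_pow,
        taylor_X_sub_C_self]
      exact dvd_mul_right _ _
    exact X_pow_dvd_iff.1 this _ (ofLex q).2.2
  · have : X ^ ((ofLex r).2 : ℕ) ∣
      taylor (x (ofLex q).1) (Q * ((∏ b ∈ Finset.Iio (ofLex r).1, (X - C (x b)) ^ t) *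
      (X - C (x (ofLex r).1)) ^ ((ofLex r).2 : ℕ))) := by
      rw [taylor_mul, taylor_mul, taylor_pow, h1, taylor_X_sub_C_self]
      exact Dvd.dvd.mul_left (dvd_mul_left _ _) _
    exact X_pow_dvd_iff.1 this _ h2

theorem hermiteForm_newtonPoly_self (x : Fin s → ℂ) (d : ℕ) (Q : ℂ[X]) (q : Fin s ×ₗ Fin t) :
    hermiteForm (p := p) x d (.inl q) (Q * newtonPoly (p := p) x (.inl q)) =
      Q.eval (x (ofLex q).1) *
        ∏ b ∈ Finset.Iio (ofLex q).1, (x (ofLex q).1 - x b) ^ t := by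
  change (taylor (x (ofLex q).1) (Q * ((∏ b ∈ Finset.Iio (ofLex q).1, (X - C (x b)) ^ t) *
      (X - C (x (ofLex q).1)) ^ ((ofLex q).2 : ℕ)))).coeff (ofLex q).2 = _
  rw [← mul_assoc, taylor_mul, taylor_pow, taylor_X_sub_C_self]
  rw [coeff_mul_X_pow', if_pos le_rfl, Nat.sub_self, taylor_coeff_zero, eval_mul, eval_prod]
  simp

theorem hermiteForm_inl_newtonPoly_inr (x : Fin s → ℂ) (d : ℕ) (Q : ℂ[X]) (q : Fin s ×ₗ Fin t)
    (i : Fin p) :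
    hermiteForm (p := p) x d (.inl q) (Q * newtonPoly (t := t) x (.inr i)) = 0 := by
  change (taylor (x (ofLex q).1) (Q * ((∏ b, (X - C (x b)) ^ t) * X ^ (i : ℕ)))).coeff
    (ofLex q).2 = 0
  have : X ^ t ∣ taylor (x (ofLex q).1) (Q * ((∏ b, (X - C (x b)) ^ t) * X ^ (i : ℕ))) := by
    rw [taylor_mul, taylor_mul]
    refine Dvd.dvd.mul_left (Dvd.dvd.mul_right ?_ _) _
    rw [← Finset.mul_prod_erase _ _ (Finset.mem_univ (ofLex q).1), taylor_mul, taylor_pow,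
      taylor_X_sub_C_self]
    exact dvd_mul_right _ _
  exact X_pow_dvd_iff.1 this _ (ofLex q).2.2

theorem hermiteForm_inr_newtonPoly_inr (x : Fin s → ℂ) (Q : ℂ[X]) (i k : Fin p) (h : k ≤ i) :
    hermiteForm (t := t) x Q.natDegree (.inr i) (Q * newtonPoly (t := t) x (.inr k)) =
      if i = k then Q.leadingCoeff else 0 := by
  change (Q * newtonPoly (t := t) x (.inr k)).coeff (Q.natDegree + s * t + i) = _
  have hd : (newtonPoly (t := t) x (.inr k)).natDegree = s * t + k := by
    rw [natDegree_newtonPoly]; simp [newtonIndex]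
  split_ifs with hik
  · rw [hik, add_assoc, ← hd, coeff_mul_degree_add_degree,
      (newtonPoly_monic x (.inr k)).leadingCoeff, mul_one]
  · have : (k : ℕ) < i := lt_of_le_of_ne h fun h' => hik (Fin.ext h'.symm)
    refine coeff_eq_zero_of_natDegree_lt (natDegree_mul_le.trans_lt ?_)
    omega

/-- The confluent Vandermonde determinant, twisted by `Q`: the matrix of the Hermite forms in the
basis `Q * newtonPoly x k` is block triangular with triangular blocks. -/
theorem det_hermiteForm_newtonPoly (x : Fin s → ℂ) (Q : ℂ[X]) :
    (Matrix.of fun i k : (Fin s ×ₗ Fin t) ⊕ Fin p =>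
      hermiteForm x Q.natDegree i (Q * newtonPoly x k)).det =
    (∏ b, (Q.eval (x b) * ∏ c ∈ Finset.Iio b, (x b - x c) ^ t)) ^ t * Q.leadingCoeff ^ p := by
  rw [← Matrix.fromBlocks_toBlocks (Matrix.of fun i k : (Fin s ×ₗ Fin t) ⊕ Fin p =>
      hermiteForm x Q.natDegree i (Q * newtonPoly x k))]
  have h12 : (Matrix.of fun i k : (Fin s ×ₗ Fin t) ⊕ Fin p =>
      hermiteForm x Q.natDegree i (Q * newtonPoly x k)).toBlocks₁₂ = 0 := by
    ext q i
    exact hermiteForm_inl_newtonPoly_inr x Q.natDegree Q q i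
  rw [h12, Matrix.det_fromBlocks_zero₁₂, Matrix.det_of_isLowerTriangular,
    Matrix.det_of_isUpperTriangular]
  · congr 1
    · have : ∀ q : Fin s ×ₗ Fin t, (Matrix.of fun i k : (Fin s ×ₗ Fin t) ⊕ Fin p =>
          hermiteForm x Q.natDegree i (Q * newtonPoly x k)).toBlocks₁₁ q q =
          Q.eval (x (ofLex q).1) * ∏ b ∈ Finset.Iio (ofLex q).1, (x (ofLex q).1 - x b) ^ t :=
        fun q => hermiteForm_newtonPoly_self x Q.natDegree Q q
      rw [Finset.prod_congr rfl fun q _ => this q,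
        Equiv.prod_comp (ofLex (α := Fin s × Fin t)) (fun q : Fin s × Fin t =>
          Q.eval (x q.1) * ∏ b ∈ Finset.Iio q.1, (x q.1 - x b) ^ t), Fintype.prod_prod_type]
      simp [Finset.prod_pow]
    · have : ∀ i : Fin p, (Matrix.of fun i k : (Fin s ×ₗ Fin t) ⊕ Fin p =>
          hermiteForm x Q.natDegree i (Q * newtonPoly x k)).toBlocks₂₂ i i = Q.leadingCoeff :=
        fun i => (hermiteForm_inr_newtonPoly_inr x Q i i le_rfl).trans (if_pos rfl)
      simp [this]
  · intro i k (h : k < i)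
    exact (hermiteForm_inr_newtonPoly_inr x Q i k h.le).trans (if_neg h.ne')
  · intro q r (h : q < r)
    exact hermiteForm_newtonPoly_of_lt x Q.natDegree Q q r h

theorem det_hermiteForm_mul (x : Fin s → ℂ) (d : ℕ) (Q : ℂ[X]) (H : Fin (s * t + p) → ℂ[X])
    (hH : ∀ k, (H k).degree < (s * t + p : ℕ)) :
    (Matrix.of fun i k : Fin (s * t + p) =>
      hermiteForm (t := t) x d (newtonIndex.symm i) (Q * H k)).det =
    (Matrix.of fun i k : Fin (s * t + p) =>
      hermiteForm (t := t) x d (newtonIndex.symm i) (Q * X ^ (k : ℕ))).det *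
    (Matrix.of fun i k : Fin (s * t + p) => (H k).coeff i).det := by
  rw [← Matrix.det_mul]
  congr 1
  ext i k
  have h1 : H k = ∑ l : Fin (s * t + p), (H k).coeff l • X ^ (l : ℕ) := by
    conv_lhs => rw [as_sum_range' (H k) (s * t + p) (by
      by_cases h0 : H k = 0
      · have := hH k
        rcases Nat.eq_zero_or_pos (s * t + p) with h | h
        · exact (Fin.elim0 (h ▸ k))
        · simpa [h0] using h
      · exact (natDegree_lt_iff_degree_lt h0).2 (hH k))]
    rw [Finset.sum_range]
    simp [← smul_X_eq_monomial]
  rw [Matrix.mul_apply]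
  simp only [Matrix.of_apply]
  conv_lhs => rw [h1, Finset.mul_sum, map_sum]
  refine Finset.sum_congr rfl fun l _ => ?_
  rw [mul_smul_comm, map_smul, smul_eq_mul, mul_comm]

/-- The basic inequality. If `s * t + p` integer polynomials `G k` of degree `< s * t + p` are
linearly independent, the determinant of the Hermite forms on the products `Q * G k` is a nonzero
integer times a confluent Vandermonde determinant, and it is at most the product of bounds for
its rows. -/
theorem prod_norm_eval_pow_mul_le (x : Fin s → ℂ) (Q : ℤ[X]) (hQ : Q ≠ 0)
    (G : Fin (s * t + p) → ℤ[X]) (hG : ∀ k, (G k).degree < (s * t + p : ℕ))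
    (hdet : (Matrix.of fun k i : Fin (s * t + p) => (G k).coeff i).det ≠ 0) (B₁ B₂ : ℝ)
    (h₁ : ∀ b k, ∀ j < t, ‖aeval (x b) (hasseDeriv j (Q * G k))‖ ≤ B₁)
    (h₂ : ∀ i k, ‖(Q * G k).coeff i‖ ≤ B₂) :
    (∏ b, ‖aeval (x b) Q‖) ^ t * (∏ b, ∏ c ∈ Finset.Iio b, ‖x b - x c‖) ^ (t * t) ≤
      (s * t + p).factorial * (B₁ ^ (s * t) * B₂ ^ p) := by
  set f := Int.castRingHom ℂ with hf
  have hinj : Function.Injective f := RingHom.injective_int _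
  have hfd : ∀ P : ℤ[X], (P.map f).natDegree = P.natDegree := natDegree_map_eq_of_injective hinj
  set A : Matrix (Fin (s * t + p)) (Fin (s * t + p)) ℂ := Matrix.of fun i k =>
    hermiteForm (t := t) x (Q.map f).natDegree (newtonIndex.symm i) (Q.map f * (G k).map f) with hA
  -- the upper bound, row by row
  have hup : ‖A.det‖ ≤ (s * t + p).factorial * (B₁ ^ (s * t) * B₂ ^ p) := by
    refine (norm_det_le_factorial_mul_prod A
      (fun i => Sum.elim (fun _ => B₁) (fun _ => B₂) (newtonIndex.symm i :
        (Fin s ×ₗ Fin t) ⊕ Fin p)) ?_).trans (le_of_eq ?_)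
    · intro i k
      rw [hA, Matrix.of_apply, ← Polynomial.map_mul]
      rcases (newtonIndex.symm i : (Fin s ×ₗ Fin t) ⊕ Fin p) with q | l
      · change ‖(taylor (x (ofLex q).1) ((Q * G k).map f)).coeff (ofLex q).2‖ ≤ B₁
        rw [coeff_taylor_map_intCast]
        exact h₁ _ _ _ (ofLex q).2.2
      · change ‖((Q * G k).map f).coeff _‖ ≤ B₂
        rw [coeff_map, hf, eq_intCast, Complex.norm_intCast, ← Int.norm_eq_abs]
        exact h₂ _ _
    · rw [Equiv.prod_comp newtonIndex.symm (Sum.elim (fun _ => B₁) (fun _ => B₂)),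
        Fintype.prod_sum_type]
      have hc : Fintype.card (Fin s ×ₗ Fin t) = s * t := by
        rw [Fintype.card_lex]; simp
      simp [hc]
  refine le_trans ?_ hup
  -- the lower bound
  have hd1 : A.det = (Matrix.of fun i k : Fin (s * t + p) =>
      hermiteForm (t := t) x (Q.map f).natDegree (newtonIndex.symm i)
        (Q.map f * X ^ (k : ℕ))).det *
      ((Matrix.of fun k i : Fin (s * t + p) => (G k).coeff i).det : ℤ) := by
    rw [hA, det_hermiteForm_mul x _ _ (fun k => (G k).map f)
      fun k => degree_map_le.trans_lt (hG k)]
    congr 1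
    rw [← Matrix.det_transpose, ← eq_intCast f, RingHom.map_det]
    congr 1
    ext k i
    simp
  have hd2 : (Matrix.of fun i k : Fin (s * t + p) =>
      hermiteForm (t := t) x (Q.map f).natDegree (newtonIndex.symm i)
        (Q.map f * X ^ (k : ℕ))).det =
      (∏ b, ((Q.map f).eval (x b) * ∏ c ∈ Finset.Iio b, (x b - x c) ^ t)) ^ t *
        (Q.map f).leadingCoeff ^ p := by
    rw [← det_hermiteForm_newtonPoly (t := t) (p := p) x (Q.map f),
      ← Matrix.det_submatrix_equiv_self newtonIndex.symm]
    have := det_hermiteForm_mul (t := t) x (Q.map f).natDegree (Q.map f)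
      (fun k : Fin (s * t + p) => newtonPoly x (newtonIndex.symm k : (Fin s ×ₗ Fin t) ⊕ Fin p))
      fun k => by
        rw [← natDegree_lt_iff_degree_lt (newtonPoly_monic _ _).ne_zero, natDegree_newtonPoly]
        simp
    rw [Matrix.det_matrixOfPolynomials _ (fun k => by rw [natDegree_newtonPoly]; simp)
      (fun k => newtonPoly_monic _ _), mul_one] at this
    rw [← this]
    rfl
  have hlead : 1 ≤ ‖(Q.map f).leadingCoeff‖ := by
    rw [leadingCoeff_map_of_injective hinj, hf, eq_intCast, Complex.norm_intCast]
    exact_mod_cast Int.one_le_abs (leadingCoeff_ne_zero.2 hQ)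
  have hint : (1 : ℝ) ≤
      ‖(((Matrix.of fun k i : Fin (s * t + p) => (G k).coeff i).det : ℤ) : ℂ)‖ := by
    rw [Complex.norm_intCast]
    exact_mod_cast Int.one_le_abs hdet
  rw [hd1, hd2, norm_mul, norm_mul, norm_pow, norm_pow, norm_prod, mul_assoc]
  have heq : ∏ b, ‖(Q.map f).eval (x b) * ∏ c ∈ Finset.Iio b, (x b - x c) ^ t‖ =
      (∏ b, ‖aeval (x b) Q‖) * (∏ b, ∏ c ∈ Finset.Iio b, ‖x b - x c‖) ^ t := by
    rw [← Finset.prod_pow, ← Finset.prod_mul_distrib]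
    refine Finset.prod_congr rfl fun b _ => ?_
    rw [norm_mul, norm_prod, ← Finset.prod_pow, aeval_def, eval₂_eq_eval_map]
    simp [hf]
  rw [heq, mul_pow, ← pow_mul]
  refine le_mul_of_one_le_right (by positivity) ?_
  exact one_le_mul_of_one_le_of_one_le (one_le_pow₀ hlead) hint

end Confluent

/-! ### Truncated weighted norms and division of Taylor expansions -/

/-- The sum of the absolute values of the coefficients of degree `< m`, the `k`-th one being
weighted by `R ^ k`: an `ℓ¹` seminorm on `ℂ[X]` that only sees `f` modulo `X ^ m`. -/
noncomputable def truncNorm (m : ℕ) (R : ℝ) (f : ℂ[X]) : ℝ :=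
  ∑ k ∈ Finset.range m, ‖f.coeff k‖ * R ^ k

section truncNorm

variable {m : ℕ} {R : ℝ}

theorem truncNorm_nonneg (hR : 0 ≤ R) (f : ℂ[X]) : 0 ≤ truncNorm m R f :=
  Finset.sum_nonneg fun _ _ => by positivity

theorem norm_coeff_mul_pow_le_truncNorm (hR : 0 ≤ R) (f : ℂ[X]) {k : ℕ} (hk : k < m) :
    ‖f.coeff k‖ * R ^ k ≤ truncNorm m R f :=
  Finset.single_le_sum (f := fun k => ‖f.coeff k‖ * R ^ k) (fun _ _ => by positivity)
    (Finset.mem_range.2 hk)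

theorem truncNorm_add_le (hR : 0 ≤ R) (f g : ℂ[X]) :
    truncNorm m R (f + g) ≤ truncNorm m R f + truncNorm m R g := by
  rw [truncNorm, truncNorm, truncNorm, ← Finset.sum_add_distrib]
  refine Finset.sum_le_sum fun k _ => ?_
  rw [← add_mul, coeff_add]
  gcongr
  exact norm_add_le _ _

theorem truncNorm_sum_le (hR : 0 ≤ R) {ι : Type*} (S : Finset ι) (f : ι → ℂ[X]) :
    truncNorm m R (∑ i ∈ S, f i) ≤ ∑ i ∈ S, truncNorm m R (f i) := by
  classical
  induction S using Finset.induction_on with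
  | empty => simp [truncNorm]
  | insert i S hi ih =>
    rw [Finset.sum_insert hi, Finset.sum_insert hi]
    exact (truncNorm_add_le hR _ _).trans (by gcongr)

theorem truncNorm_C_mul (c : ℂ) (f : ℂ[X]) : truncNorm m R (C c * f) = ‖c‖ * truncNorm m R f := by
  rw [truncNorm, truncNorm, Finset.mul_sum]
  simp [mul_assoc]

theorem truncNorm_C_le (c : ℂ) : truncNorm m R (C c) ≤ ‖c‖ := by
  rcases m with _ | m
  · simp [truncNorm]
  · rw [truncNorm, Finset.sum_range_succ']
    simp [coeff_C]

theorem truncNorm_X_le (hR : 0 ≤ R) : truncNorm m R X ≤ R := by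
  refine (Finset.sum_le_sum_of_subset_of_nonneg (Finset.range_mono (Nat.le_add_right m 2))
    fun _ _ _ => by positivity).trans ?_
  rw [Finset.sum_range_succ', Finset.sum_range_succ']
  simp [coeff_X]

theorem truncNorm_eq_zero_of_dvd {f : ℂ[X]} (h : X ^ m ∣ f) : truncNorm m R f = 0 :=
  Finset.sum_eq_zero fun k hk => by rw [X_pow_dvd_iff.1 h k (Finset.mem_range.1 hk)]; simp

theorem truncNorm_mul_le (hR : 0 ≤ R) (f g : ℂ[X]) :
    truncNorm m R (f * g) ≤ truncNorm m R f * truncNorm m R g := by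
  have h1 : truncNorm m R (f * g) ≤ ∑ k ∈ Finset.range m,
      ∑ q ∈ Finset.HasAntidiagonal.antidiagonal k, (‖f.coeff q.1‖ * R ^ q.1) * (‖g.coeff q.2‖ * R ^ q.2) := by
    refine Finset.sum_le_sum fun k _ => ?_
    rw [coeff_mul]
    refine (mul_le_mul_of_nonneg_right (norm_sum_le _ _) (by positivity)).trans (le_of_eq ?_)
    rw [Finset.sum_mul]
    refine Finset.sum_congr rfl fun q hq => ?_
    rw [← Finset.HasAntidiagonal.mem_antidiagonal.1 hq, norm_mul, pow_add]
    ring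
  refine h1.trans ?_
  rw [truncNorm, truncNorm, Finset.sum_mul_sum, ← Finset.sum_product', ← Finset.sum_biUnion]
  · refine Finset.sum_le_sum_of_subset_of_nonneg ?_ fun _ _ _ => by positivity
    rintro ⟨i, j⟩ h
    simp only [Finset.mem_biUnion, Finset.mem_range, Finset.HasAntidiagonal.mem_antidiagonal,
      Finset.mem_product] at h ⊢
    omega
  · intro k _ l _ hkl
    refine Finset.disjoint_left.2 fun q hq hq' => hkl ?_
    rw [← Finset.HasAntidiagonal.mem_antidiagonal.1 hq,
      ← Finset.HasAntidiagonal.mem_antidiagonal.1 hq']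

theorem truncNorm_pow_le (hR : 0 ≤ R) (f : ℂ[X]) (n : ℕ) :
    truncNorm m R (f ^ n) ≤ truncNorm m R f ^ n := by
  induction n with
  | zero => simpa using truncNorm_C_le (m := m) (R := R) 1
  | succ n ih =>
    rw [pow_succ, pow_succ]
    exact (truncNorm_mul_le hR _ _).trans
      (mul_le_mul_of_nonneg_right ih (truncNorm_nonneg hR _))

/-- Division: if the constant term of `h` dominates the other terms, multiplication by `h` cannot
decrease `truncNorm` much. -/
theorem mul_truncNorm_le_truncNorm_mul (hR : 0 ≤ R) (g h : ℂ[X]) (ε : ℝ)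
    (hε : ε + truncNorm m R (h - C (h.coeff 0)) ≤ ‖h.coeff 0‖) :
    ε * truncNorm m R g ≤ truncNorm m R (g * h) := by
  have h1 : ‖h.coeff 0‖ * truncNorm m R g ≤
      truncNorm m R (g * h) + truncNorm m R (h - C (h.coeff 0)) * truncNorm m R g := by
    rw [← truncNorm_C_mul]
    have : C (h.coeff 0) * g = g * h + C (-1) * ((h - C (h.coeff 0)) * g) := by
      simp; ring
    rw [this]
    refine (truncNorm_add_le hR _ _).trans ?_
    rw [truncNorm_C_mul]
    simpa using truncNorm_mul_le hR _ _
  have := mul_le_mul_of_nonneg_right hε (truncNorm_nonneg (m := m) hR g)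
  linarith

theorem pow_mul_truncNorm_le_truncNorm_mul_pow (hR : 0 ≤ R) (g h : ℂ[X]) (ε : ℝ) (hε₀ : 0 ≤ ε)
    (hε : ε + truncNorm m R (h - C (h.coeff 0)) ≤ ‖h.coeff 0‖) (n : ℕ) :
    ε ^ n * truncNorm m R g ≤ truncNorm m R (g * h ^ n) := by
  induction n with
  | zero => simp
  | succ n ih =>
    rw [pow_succ', pow_succ, mul_assoc, ← mul_assoc g]
    exact (mul_le_mul_of_nonneg_left ih hε₀).trans
      (mul_truncNorm_le_truncNorm_mul hR _ _ _ hε)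

theorem truncNorm_sub_C_coeff_zero_le (hR : 0 ≤ R) (hR1 : R ≤ 1) (h : ℂ[X]) :
    truncNorm m R (h - C (h.coeff 0)) ≤ R * truncNorm m 1 h := by
  rw [truncNorm, truncNorm, Finset.mul_sum]
  refine Finset.sum_le_sum fun k _ => ?_
  rcases k with _ | k
  · simp; positivity
  · rw [coeff_sub, coeff_C_succ, sub_zero, one_pow, mul_one, mul_comm, pow_succ']
    have : R ^ k ≤ 1 := pow_le_one₀ hR hR1
    have h2 : R * R ^ k ≤ R := mul_le_of_le_one_right hR this
    gcongr

theorem truncNorm_comp_le (hR : 0 ≤ R) (g v : ℂ[X]) (hv : X ∣ v) :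
    truncNorm m R (g.comp v) ≤ ∑ k ∈ Finset.range m, ‖g.coeff k‖ * truncNorm m R v ^ k := by
  rw [comp_eq_sum_left, sum_over_range' _ (by simp) (m + (g.natDegree + 1)) (by omega)]
  refine (truncNorm_sum_le hR _ _).trans ?_
  rw [Finset.sum_range_add]
  have h0 : ∑ k ∈ Finset.range (g.natDegree + 1),
      truncNorm m R (C (g.coeff (m + k)) * v ^ (m + k)) = 0 :=
    Finset.sum_eq_zero fun k _ => truncNorm_eq_zero_of_dvd
      (((pow_dvd_pow _ (Nat.le_add_right m k)).trans (pow_dvd_pow_of_dvd hv _)).mul_left _)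
  rw [h0, add_zero]
  refine Finset.sum_le_sum fun k _ => ?_
  rw [truncNorm_C_mul]
  gcongr
  exact truncNorm_pow_le hR _ _

theorem truncNorm_X_add_C_le (z : ℂ) : truncNorm m 1 (X + C z) ≤ 1 + ‖z‖ :=
  (truncNorm_add_le zero_le_one _ _).trans
    (add_le_add (truncNorm_X_le zero_le_one) (truncNorm_C_le _))

theorem truncNorm_taylor_prod_le (z : ℂ) (S : Multiset ℂ) (hS : ∀ ζ ∈ S, ‖ζ‖ ≤ 1) :
    truncNorm m 1 (taylor z (S.map fun ζ => X - C ζ).prod) ≤ (2 + ‖z‖) ^ S.card := by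
  induction S using Multiset.induction_on with
  | empty => simpa using truncNorm_C_le (m := m) (R := 1) 1
  | cons ζ S ih =>
    rw [Multiset.map_cons, Multiset.prod_cons, taylor_mul, Multiset.card_cons, pow_succ']
    refine (truncNorm_mul_le zero_le_one _ _).trans ?_
    have h1 : truncNorm m 1 (taylor z (X - C ζ)) ≤ 2 + ‖z‖ := by
      have h2 : taylor z (X - C ζ) = X + C (z - ζ) := by simp; ring
      rw [h2]
      refine (truncNorm_X_add_C_le _).trans ?_
      have := norm_sub_le z ζ
      have := hS ζ (Multiset.mem_cons_self _ _)
      linarith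
    exact mul_le_mul h1 (ih fun ζ' h => hS ζ' (Multiset.mem_cons_of_mem h))
      (truncNorm_nonneg zero_le_one _) (by positivity)

end truncNorm

/-- The Taylor coefficients at `z` of a cofactor `g` of `p = g * X ^ r * Φ ^ t` are controlled by
those of `p` of the same orders, on a disc of radius `R` on which `X` and `Φ` do not vary much. -/
theorem norm_coeff_taylor_mul_le {p g Φ : ℂ[X]} {r t m : ℕ} {z : ℂ} {δ η R : ℝ}
    (hfac : p = g * X ^ r * Φ ^ t) (hΦ : Φ.Monic) (hroots : ∀ ζ ∈ Φ.roots, ‖ζ‖ ≤ 1)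
    (hδ : ∀ k < m, ‖(taylor z p).coeff k‖ ≤ δ) (hη : η ≤ ‖Φ.eval z‖) (hη0 : 0 ≤ η)
    (hδ0 : 0 ≤ δ) (hR : 0 ≤ R) (hR1 : R ≤ 1 / 2) (hRz : R ≤ ‖z‖ / 2)
    (hRΦ : R * (2 + ‖z‖) ^ Φ.natDegree ≤ η / 2) (k : ℕ) (hk : k < m) :
    ‖(taylor z g).coeff k‖ * R ^ k * (‖z‖ / 2) ^ r * (η / 2) ^ t ≤ 2 * δ := by
  have hup : truncNorm m R (taylor z p) ≤ 2 * δ := by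
    calc truncNorm m R (taylor z p) ≤ ∑ k ∈ Finset.range m, δ * (1 / 2) ^ k := by
          refine Finset.sum_le_sum fun k hk => ?_
          have := hδ k (Finset.mem_range.1 hk)
          gcongr
      _ = δ * ∑ k ∈ Finset.range m, (1 / 2 : ℝ) ^ k := by rw [Finset.mul_sum]
      _ ≤ δ * 2 := by gcongr; exact sum_geometric_two_le m
      _ = 2 * δ := mul_comm _ _
  have hX : ‖z‖ / 2 + truncNorm m R (taylor z X - C ((taylor z X).coeff 0)) ≤
      ‖(taylor z X).coeff 0‖ := by
    have : taylor z X - C ((taylor z X).coeff 0) = X := by simp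
    rw [this, taylor_coeff_zero, eval_X]
    have := truncNorm_X_le (m := m) hR
    linarith
  have hΦ' : η / 2 + truncNorm m R (taylor z Φ - C ((taylor z Φ).coeff 0)) ≤
      ‖(taylor z Φ).coeff 0‖ := by
    rw [taylor_coeff_zero]
    have h1 := truncNorm_sub_C_coeff_zero_le (m := m) hR (by linarith) (taylor z Φ)
    rw [taylor_coeff_zero] at h1
    have h2 : truncNorm m 1 (taylor z Φ) ≤ (2 + ‖z‖) ^ Φ.natDegree := by
      have hs := IsAlgClosed.splits Φ
      have h3 := truncNorm_taylor_prod_le (m := m) z Φ.roots hroots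
      rwa [← hs.eq_prod_roots_of_monic hΦ, ← hs.natDegree_eq_card_roots] at h3
    have := mul_le_mul_of_nonneg_left h2 hR
    linarith
  calc ‖(taylor z g).coeff k‖ * R ^ k * (‖z‖ / 2) ^ r * (η / 2) ^ t
      ≤ truncNorm m R (taylor z g) * (‖z‖ / 2) ^ r * (η / 2) ^ t := by
        gcongr
        exact norm_coeff_mul_pow_le_truncNorm hR _ hk
    _ = (η / 2) ^ t * ((‖z‖ / 2) ^ r * truncNorm m R (taylor z g)) := by ring
    _ ≤ (η / 2) ^ t * truncNorm m R (taylor z g * taylor z X ^ r) := by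
        gcongr
        exact pow_mul_truncNorm_le_truncNorm_mul_pow hR _ _ _ (by positivity) hX r
    _ ≤ truncNorm m R (taylor z g * taylor z X ^ r * taylor z Φ ^ t) :=
        pow_mul_truncNorm_le_truncNorm_mul_pow hR _ _ _ (by positivity) hΦ' t
    _ = truncNorm m R (taylor z p) := by
        rw [hfac, taylor_mul, taylor_mul, taylor_pow, taylor_pow]
    _ ≤ 2 * δ := hup

/-! ### Estimates for the cofactor and for its derivatives -/

/-- The case `R = η / (2 κ ^ (a D + a))` of `norm_coeff_taylor_mul_le`, with `D = deg Φ`: the powers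
of `R`, of `‖z‖` and of `2` are absorbed in a power of `κ`. The exponent `3t` of `η` is made of `t`
divisions by `Φ` and of the factor `R ^ k` with `k ≤ 2t`. -/
theorem norm_coeff_taylor_cofactor_le {p g Φ : ℂ[X]} {r t n a M : ℕ} {z : ℂ} {δ η κ : ℝ}
    (hfac : p = g * X ^ r * Φ ^ t) (hΦ : Φ.Monic) (hroots : ∀ ζ ∈ Φ.roots, ‖ζ‖ ≤ 1)
    (hδ : ∀ k < 2 * t - 1, ‖(taylor z p).coeff k‖ ≤ δ) (hη : η ≤ ‖Φ.eval z‖) (hη0 : 0 < η)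
    (hη1 : η ≤ 1) (hδ0 : 0 ≤ δ) (hκ : 2 ≤ κ) (hz : 2 + ‖z‖ ≤ κ ^ a) (hz' : 1 ≤ κ ^ a * ‖z‖)
    (ha : 1 ≤ a) (haM : a ≤ M) (ht : 1 ≤ t) (htn : t ≤ n) (hdeg : r + t * Φ.natDegree ≤ n)
    (k : ℕ) (hk : k < 2 * t - 1) :
    ‖(taylor z g).coeff k‖ ≤ δ / η ^ (3 * t) * κ ^ (9 * (M * n)) := by
  set D := Φ.natDegree
  have hκ0 : 0 < κ := by linarith
  have hκ1 : 1 ≤ κ := by linarith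
  have hone : ∀ e : ℕ, 1 ≤ κ ^ e := fun e => one_le_pow₀ hκ1
  set R := η / (2 * κ ^ (a * D + a)) with hRdef
  have hR : 0 < R := by positivity
  have hRmul : R * κ ^ (a * D + a) = η / 2 := by
    rw [hRdef]; field_simp
  have hR1 : R ≤ 1 / 2 := by
    have := le_mul_of_one_le_right hR.le (hone (a * D + a))
    linarith
  have hRz : R ≤ ‖z‖ / 2 := by
    have h1 : R * κ ^ a ≤ η / 2 := by
      rw [← hRmul]
      gcongr
      omega
    have h2 : R * κ ^ a ≤ ‖z‖ / 2 * κ ^ a := by nlinarith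
    exact le_of_mul_le_mul_right h2 (by positivity)
  have hRΦ : R * (2 + ‖z‖) ^ D ≤ η / 2 := by
    rw [← hRmul]
    have : (2 + ‖z‖) ^ D ≤ κ ^ (a * D) := by
      rw [pow_mul]; gcongr
    refine mul_le_mul_of_nonneg_left (this.trans ?_) hR.le
    exact pow_le_pow_right₀ hκ1 (by omega)
  have key := norm_coeff_taylor_mul_le hfac hΦ hroots hδ hη hη0.le hδ0 hR.le hR1 hRz hRΦ k hk
  have hRk : R ^ (2 * t) ≤ R ^ k := pow_le_pow_of_le_one hR.le (by linarith) (by omega)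
  have e1 : η ^ (2 * t) = R ^ (2 * t) * 2 ^ (2 * t) * κ ^ ((a * D + a) * (2 * t)) := by
    rw [pow_mul κ, ← mul_pow, ← mul_pow, mul_right_comm, hRmul]
    ring_nf
  have e2 : 1 ≤ (‖z‖ / 2) ^ r * 2 ^ r * κ ^ (a * r) := by
    rw [pow_mul κ, ← mul_pow, ← mul_pow]
    exact one_le_pow₀ (by linarith)
  have e3 : η ^ t = (η / 2) ^ t * 2 ^ t := by
    rw [← mul_pow]; ring_nf
  rw [div_mul_eq_mul_div, le_div_iff₀ (by positivity)]
  set G := ‖(taylor z g).coeff k‖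
  have hG : 0 ≤ G := norm_nonneg _
  calc G * η ^ (3 * t) = G * η ^ (2 * t) * 1 * η ^ t := by ring
    _ ≤ G * η ^ (2 * t) * ((‖z‖ / 2) ^ r * 2 ^ r * κ ^ (a * r)) * η ^ t := by gcongr
    _ = G * R ^ (2 * t) * (‖z‖ / 2) ^ r * (η / 2) ^ t *
        (2 ^ (2 * t + r + t) * κ ^ ((a * D + a) * (2 * t) + a * r)) := by
        rw [e1, e3]; ring
    _ ≤ G * R ^ k * (‖z‖ / 2) ^ r * (η / 2) ^ t *
        (2 ^ (2 * t + r + t) * κ ^ ((a * D + a) * (2 * t) + a * r)) := by gcongr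
    _ ≤ 2 * δ * (2 ^ (2 * t + r + t) * κ ^ ((a * D + a) * (2 * t) + a * r)) := by gcongr
    _ = δ * (2 ^ (2 * t + r + t + 1) * κ ^ ((a * D + a) * (2 * t) + a * r)) := by ring
    _ ≤ δ * (κ ^ (2 * t + r + t + 1) * κ ^ ((a * D + a) * (2 * t) + a * r)) := by gcongr
    _ = δ * κ ^ (2 * t + r + t + 1 + ((a * D + a) * (2 * t) + a * r)) := by rw [← pow_add]
    _ ≤ δ * κ ^ (9 * (M * n)) := by
        gcongr
        · have h1 : a * (r + t * D) ≤ M * n := Nat.mul_le_mul haM hdeg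
          have h2 : a * t ≤ M * n := Nat.mul_le_mul haM htn
          have h3 : r + t * D ≤ M * n := by nlinarith
          have h4 : t ≤ M * n := by nlinarith
          nlinarith [Nat.zero_le (a * r), Nat.zero_le (t * D)]

/-- The Taylor coefficients at `w` of `X ^ i * g^{[j]}(X ^ a)` in terms of those of `g` at `w ^ a`
of order at most `2t - 2`. -/
theorem norm_coeff_taylor_X_pow_mul_comp_le {g : ℂ[X]} {i j l a t N : ℕ} {w : ℂ} {B κ : ℝ}
    (hB : ∀ k < 2 * t - 1, ‖(taylor (w ^ a) g).coeff k‖ ≤ B) (hκ : 3 ≤ κ)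
    (hw : 1 + ‖w‖ ≤ κ) (hi : i < 2 * N) (hj : j < t) (hl : l < t) (hat : a * t ≤ N) (ha : 1 ≤ a) :
    ‖(taylor w (X ^ i * (hasseDeriv j g).comp (X ^ a))).coeff l‖ ≤ B * κ ^ (5 * N) := by
  have hκ1 : 1 ≤ κ := by linarith
  have hB0 : 0 ≤ B := (norm_nonneg _).trans (hB 0 (by omega))
  have hXw : truncNorm t 1 (X + C w) ≤ κ := (truncNorm_X_add_C_le w).trans hw
  -- `v` is the increment of `X ^ a` at `w`; it is divisible by `X`
  set v : ℂ[X] := (X + C w) ^ a - C (w ^ a) with hv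
  have hv0 : v = (X + C w) ^ a - C (((X + C w) ^ a).coeff 0) := by
    rw [hv, coeff_zero_eq_eval_zero]; simp
  have hXv : X ∣ v := by
    rw [X_dvd_iff, hv0]; simp
  have hvle : truncNorm t 1 v ≤ κ ^ a := by
    rw [hv0]
    refine (truncNorm_sub_C_coeff_zero_le zero_le_one le_rfl _).trans ?_
    rw [one_mul]
    exact (truncNorm_pow_le zero_le_one _ _).trans
      (pow_le_pow_left₀ (truncNorm_nonneg zero_le_one _) hXw _)
  have hcomp : taylor w ((hasseDeriv j g).comp (X ^ a)) =
      (taylor (w ^ a) (hasseDeriv j g)).comp v := by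
    rw [taylor_apply, taylor_apply, comp_assoc, comp_assoc, hv]
    simp
  have hcoef : ∀ k < t, ‖(taylor (w ^ a) (hasseDeriv j g)).coeff k‖ ≤ 4 ^ t * B := by
    intro k hk
    have h1 : (taylor (w ^ a) (hasseDeriv j g)).coeff k =
        ((k + j).choose k : ℂ) * (taylor (w ^ a) g).coeff (k + j) := by
      rw [taylor_coeff, taylor_coeff, ← LinearMap.comp_apply, hasseDeriv_comp]
      simp
    rw [h1, norm_mul, Complex.norm_natCast]
    have h2 : ((k + j).choose k : ℝ) ≤ 4 ^ t := by
      have h3 : (k + j).choose k ≤ 2 ^ (2 * t) :=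
        (Nat.choose_le_two_pow _ _).trans (Nat.pow_le_pow_right (by norm_num) (by omega))
      rw [pow_mul] at h3
      exact_mod_cast h3
    have := hB (k + j) (by omega)
    gcongr
  have hmain : truncNorm t 1 (taylor w ((hasseDeriv j g).comp (X ^ a))) ≤
      t * (4 ^ t * B * κ ^ N) := by
    rw [hcomp]
    refine (truncNorm_comp_le zero_le_one _ _ hXv).trans ?_
    have : ∀ k ∈ Finset.range t, ‖(taylor (w ^ a) (hasseDeriv j g)).coeff k‖ *
        truncNorm t 1 v ^ k ≤ 4 ^ t * B * κ ^ N := by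
      intro k hk
      have hk' := Finset.mem_range.1 hk
      have h1 : truncNorm t 1 v ^ k ≤ κ ^ N := by
        refine (pow_le_pow_left₀ (truncNorm_nonneg zero_le_one _) hvle _).trans ?_
        rw [← pow_mul]
        exact pow_le_pow_right₀ hκ1 ((Nat.mul_le_mul_left a hk'.le).trans hat)
      have h2 := hcoef k hk'
      have h3 := truncNorm_nonneg (m := t) zero_le_one v
      gcongr
    refine (Finset.sum_le_card_nsmul _ _ _ this).trans ?_
    simp
  have htN : t ≤ N := by nlinarith
  have ht8 : (t : ℝ) * 4 ^ t ≤ κ ^ (2 * N) := by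
    have h1 : (t : ℝ) ≤ 2 ^ t := by exact_mod_cast Nat.lt_two_pow_self.le
    calc (t : ℝ) * 4 ^ t ≤ 2 ^ t * 4 ^ t := by gcongr
      _ = 8 ^ t := by rw [← mul_pow]; norm_num
      _ ≤ (κ ^ 2) ^ t := by gcongr; nlinarith
      _ = κ ^ (2 * t) := by rw [pow_mul]
      _ ≤ κ ^ (2 * N) := pow_le_pow_right₀ hκ1 (by omega)
  have hXi : truncNorm t 1 (taylor w (X ^ i)) ≤ κ ^ (2 * N) := by
    rw [taylor_X_pow]
    exact ((truncNorm_pow_le zero_le_one _ _).trans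
      (pow_le_pow_left₀ (truncNorm_nonneg zero_le_one _) hXw _)).trans
      (pow_le_pow_right₀ hκ1 hi.le)
  have hfin := norm_coeff_mul_pow_le_truncNorm zero_le_one
    (taylor w (X ^ i * (hasseDeriv j g).comp (X ^ a))) hl
  rw [one_pow, mul_one, taylor_mul] at hfin
  rw [taylor_mul]
  refine hfin.trans ((truncNorm_mul_le zero_le_one _ _).trans ?_)
  calc _ ≤ κ ^ (2 * N) * (t * (4 ^ t * B * κ ^ N)) :=
        mul_le_mul hXi hmain (truncNorm_nonneg zero_le_one _) (by positivity)
    _ = (t * 4 ^ t) * (B * κ ^ (3 * N)) := by ring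
    _ ≤ κ ^ (2 * N) * (B * κ ^ (3 * N)) := by gcongr
    _ = B * κ ^ (5 * N) := by ring

/-- Multiplication by a monic polynomial without zeros outside the closed unit disc preserves the
Mahler measure; hence the coefficients of a cofactor of `p` are not much larger than those
of `p`. -/
theorem norm_coeff_cofactor_le {p g h : ℂ[X]} {n : ℕ} {H : ℝ} (hfac : p = g * h) (hh : h.Monic)
    (hroots : ∀ ζ ∈ h.roots, ‖ζ‖ ≤ 1) (hp0 : p ≠ 0) (hp : p.natDegree ≤ n)
    (hH : ∀ i, ‖p.coeff i‖ ≤ H) (i : ℕ) : ‖g.coeff i‖ ≤ 4 ^ n * H := by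
  have hH0 : 0 ≤ H := (norm_nonneg _).trans (hH 0)
  have hg0 : g ≠ 0 := by rintro rfl; simp [hfac] at hp0
  have hMh : h.mahlerMeasure = 1 := by
    rw [mahlerMeasure_eq_leadingCoeff_mul_prod_roots, hh.leadingCoeff, norm_one, one_mul]
    refine Multiset.prod_eq_one fun x hx => ?_
    obtain ⟨ζ, hζ, rfl⟩ := Multiset.mem_map.1 hx
    exact max_eq_left (hroots ζ hζ)
  have hM : g.mahlerMeasure = p.mahlerMeasure := by
    rw [hfac, mahlerMeasure_mul, hMh, mul_one]
  have hMp : p.mahlerMeasure ≤ 2 ^ n * H := by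
    refine (mahlerMeasure_le_sum_norm_coeff p).trans ?_
    rw [sum_over_range' _ (by simp) (n + 1) (by omega)]
    refine (Finset.sum_le_card_nsmul _ _ H fun i _ => hH i).trans ?_
    rw [Finset.card_range, nsmul_eq_mul]
    gcongr
    exact_mod_cast Nat.lt_two_pow_self
  have hgn : g.natDegree ≤ n := by
    have : p.natDegree = g.natDegree + h.natDegree := by
      rw [hfac, natDegree_mul hg0 hh.ne_zero]
    omega
  have hch : (g.natDegree.choose i : ℝ) ≤ 2 ^ n := by
    exact_mod_cast (Nat.choose_le_two_pow _ _).trans (Nat.pow_le_pow_right (by norm_num) hgn)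
  calc ‖g.coeff i‖ ≤ g.natDegree.choose i * g.mahlerMeasure :=
        norm_coeff_le_choose_mul_mahlerMeasure i g
    _ ≤ 2 ^ n * (2 ^ n * H) := by
        rw [hM]
        exact mul_le_mul hch hMp (mahlerMeasure_nonneg _) (by positivity)
    _ = 4 ^ n * H := by rw [← mul_assoc, ← mul_pow]; norm_num

theorem norm_coeff_X_pow_mul_comp_le {g : ℤ[X]} {n i j a : ℕ} {H : ℝ} (hg : g.natDegree ≤ n)
    (hH : ∀ k, ‖g.coeff k‖ ≤ H) (ha : 1 ≤ a) (k : ℕ) :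
    ‖(X ^ i * (hasseDeriv j g).comp (X ^ a)).coeff k‖ ≤ 2 ^ n * H := by
  have hH0 : 0 ≤ H := (norm_nonneg _).trans (hH 0)
  have h1 : ∀ l, ‖(hasseDeriv j g).coeff l‖ ≤ 2 ^ n * H := by
    intro l
    rw [hasseDeriv_coeff]
    rcases le_or_gt (l + j) n with hl | hl
    · rw [norm_mul, Int.norm_natCast]
      have : ((l + j).choose j : ℝ) ≤ 2 ^ n := by
        exact_mod_cast (Nat.choose_le_two_pow _ _).trans (Nat.pow_le_pow_right (by norm_num) hl)
      exact mul_le_mul this (hH _) (norm_nonneg _) (by positivity)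
    · rw [coeff_eq_zero_of_natDegree_lt (by omega), mul_zero, norm_zero]
      positivity
  have h0 : 0 ≤ 2 ^ n * H := by positivity
  rw [coeff_X_pow_mul', ← expand_eq_comp_X_pow, coeff_expand (by omega)]
  split_ifs <;> simp only [norm_zero, h0, h1]

/-! ### The quantities attached to the finite set `E` -/

theorem bigDelta_pos (E : Finset ℂ) : 0 < bigDelta E := by
  refine Finset.prod_pos fun q hq => Real.rpow_pos_of_pos (norm_pos_iff.2 ?_) _
  exact sub_ne_zero.2 (Finset.mem_offDiag.1 hq).2.2.symm

/-- Each unordered pair of points of `E` contributes twice the square root of its distance to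
`bigDelta E`. -/
theorem bigDelta_eq_prod_Iio {s : ℕ} (E : Finset ℂ) (x : Fin s → ℂ) (hx : Function.Injective x)
    (hE : E = Finset.univ.map ⟨x, hx⟩) :
    bigDelta E = ∏ b, ∏ c ∈ Finset.Iio b, ‖x b - x c‖ := by
  set T : Finset (Fin s × Fin s) := Finset.univ.filter fun q => q.2 < q.1
  have h1 : bigDelta E = ∏ q ∈ (Finset.univ : Finset (Fin s)).offDiag,
      ‖x q.2 - x q.1‖ ^ (1 / 2 : ℝ) := by
    rw [bigDelta]
    symm
    refine Finset.prod_bij (fun q _ => (x q.1, x q.2)) ?_ ?_ ?_ ?_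
    · intro q hq
      simpa [hE, hx.eq_iff] using hq
    · intro q _ q' _ h
      exact Prod.ext (hx (Prod.ext_iff.1 h).1) (hx (Prod.ext_iff.1 h).2)
    · rintro ⟨y, z⟩ h
      simp only [hE, Finset.mem_offDiag, Finset.mem_map, Finset.mem_univ, true_and,
        Function.Embedding.coeFn_mk] at h
      obtain ⟨⟨b, rfl⟩, ⟨c, rfl⟩, hbc⟩ := h
      exact ⟨(b, c), by simpa [hx.eq_iff] using hbc, rfl⟩
    · intro _ _; rfl
  have h2 : (Finset.univ : Finset (Fin s)).offDiag = T ∪ T.map (Equiv.prodComm _ _).toEmbedding := by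
    ext ⟨b, c⟩
    simp [T, Finset.mem_map_equiv, ne_comm]
  have h3 : Disjoint T (T.map (Equiv.prodComm _ _).toEmbedding) := by
    rw [Finset.disjoint_left]
    rintro ⟨b, c⟩ h h'
    simp [T, Finset.mem_map_equiv] at h h'
    exact lt_asymm h h'
  rw [h1, h2, Finset.prod_union h3, Finset.prod_map, ← Finset.prod_mul_distrib,
    ← Finset.prod_finset_product' T Finset.univ (fun b => Finset.Iio b) (by simp [T])
      (f := fun b c => ‖x b - x c‖)]
  refine Finset.prod_congr rfl fun q _ => ?_
  simp only [Equiv.coe_toEmbedding, Equiv.prodComm_apply, Prod.fst_swap, Prod.snd_swap]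
  rw [norm_sub_rev (x q.2), ← Real.sqrt_eq_rpow, Real.mul_self_sqrt (norm_nonneg _)]

theorem norm_le_constE {E : Finset ℂ} (hE : E.Nonempty) {ξ : ℂ} (hξ : ξ ∈ E) :
    ‖ξ‖ ≤ constE E hE :=
  (le_max_left _ _).trans (Finset.le_sup' (fun ξ : ℂ => max ‖ξ‖ ‖ξ‖⁻¹) hξ)

theorem inv_norm_le_constE {E : Finset ℂ} (hE : E.Nonempty) {ξ : ℂ} (hξ : ξ ∈ E) :
    ‖ξ‖⁻¹ ≤ constE E hE :=
  (le_max_right _ _).trans (Finset.le_sup' (fun ξ : ℂ => max ‖ξ‖ ‖ξ‖⁻¹) hξ)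

theorem one_le_constE {E : Finset ℂ} (hE : E.Nonempty) (hE0 : ∀ ξ ∈ E, ξ ≠ 0) :
    1 ≤ constE E hE := by
  obtain ⟨ξ, hξ⟩ := id hE
  rcases le_total 1 ‖ξ‖ with h | h
  · exact h.trans (norm_le_constE hE hξ)
  · exact (one_le_inv₀ (norm_pos_iff.2 (hE0 ξ hξ)) |>.2 h).trans (inv_norm_le_constE hE hξ)

theorem two_add_pow_le {c : ℝ} (hc : 0 ≤ c) {a : ℕ} (ha : 1 ≤ a) : 2 + c ^ a ≤ (2 + c) ^ a := by
  induction a, ha using Nat.le_induction with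
  | base => simp
  | succ a _ ih =>
    rw [pow_succ (2 + c)]
    have h1 : 0 ≤ c ^ a := by positivity
    have h2 := mul_le_mul_of_nonneg_right ih (by linarith : 0 ≤ 2 + c)
    rw [pow_succ]
    nlinarith

theorem deltaPhi_le {Φ : ℤ[X]} {A : Finset ℕ} (hA : A.Nonempty) {E : Finset ℂ} (hE : E.Nonempty)
    {a : ℕ} (ha : a ∈ A) {ξ : ℂ} (hξ : ξ ∈ E) : deltaPhi Φ A hA E hE ≤ ‖aeval (ξ ^ a) Φ‖ :=
  (Finset.inf'_le _ ha).trans (Finset.inf'_le (fun ξ : ℂ => ‖aeval (ξ ^ a) Φ‖) hξ)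

theorem deltaPhi_pos {Φ : ℤ[X]} (hΦ : IsCyclotomicPoly Φ) {A : Finset ℕ} (hA : A.Nonempty)
    (hA0 : ∀ a ∈ A, 0 < a) {E : Finset ℂ} (hE : E.Nonempty) (hEtor : ∀ ξ ∈ E, ¬ IsOfFinOrder ξ) :
    0 < deltaPhi Φ A hA E hE := by
  refine (Finset.lt_inf'_iff _).2 fun a ha => (Finset.lt_inf'_iff _).2 fun ξ hξ => ?_
  refine norm_pos_iff.2 fun h => hEtor ξ hξ ?_
  exact (isOfFinOrder_pow.1 (hΦ.2 _ h)).resolve_right (hA0 a ha).ne'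

theorem norm_hasseDeriv_le_deltaP {P : ℤ[X]} {t : ℕ} (ht : 1 ≤ t) {A : Finset ℕ} (hA : A.Nonempty)
    {E : Finset ℂ} (hE : E.Nonempty) {a : ℕ} (ha : a ∈ A) {ξ : ℂ} (hξ : ξ ∈ E) {k : ℕ}
    (hk : k < 2 * t - 1) :
    ‖aeval (ξ ^ a) (hasseDeriv k P)‖ ≤ deltaP P t ht A hA E hE :=
  le_trans (le_trans (Finset.le_sup' (fun k => ‖aeval (ξ ^ a) (hasseDeriv k P)‖)
    (Finset.mem_range.2 hk)) (Finset.le_sup' (fun ξ : ℂ => (Finset.range (2 * t - 1)).sup'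
      (Finset.nonempty_range_iff.mpr (by omega)) fun j => ‖aeval (ξ ^ a) (hasseDeriv j P)‖) hξ))
    (Finset.le_sup' (fun a => E.sup' hE fun ξ : ℂ => (Finset.range (2 * t - 1)).sup'
      (Finset.nonempty_range_iff.mpr (by omega)) fun j => ‖aeval (ξ ^ a) (hasseDeriv j P)‖) ha)

/-! ### Reduction to primitive polynomials -/

theorem one_le_content {P : ℤ[X]} (hP : P ≠ 0) : (1 : ℝ) ≤ P.content := by
  have h1 : P.content ≠ 0 := mt content_eq_zero_iff.1 hP
  have h2 : 0 ≤ P.content := Int.nonneg_of_normalize_eq_self normalize_content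
  exact_mod_cast lt_of_le_of_ne h2 h1.symm

theorem aeval_eq_content_mul_aeval_primPart (P : ℤ[X]) (z : ℂ) :
    aeval z P = (P.content : ℂ) * aeval z P.primPart := by
  conv_lhs => rw [P.eq_C_content_mul_primPart]
  simp

theorem norm_coeff_primPart_le_intHeight {P : ℤ[X]} (hP : P ≠ 0) (i : ℕ) :
    ‖P.primPart.coeff i‖ ≤ intHeight P := by
  have h1 := one_le_content hP
  rw [intHeight, le_div_iff₀ (by linarith)]
  refine le_trans (le_of_eq ?_) (P.le_supNorm i)
  conv_rhs => rw [P.eq_C_content_mul_primPart]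
  rw [coeff_C_mul, norm_mul, mul_comm, Int.norm_eq_abs P.content, abs_of_nonneg (by linarith)]

theorem primPart_eq_mul {P P₀ h : ℤ[X]} (hP : P ≠ 0) (hfac : P = P₀ * h) (hh : h.Monic) :
    P.primPart = P₀.primPart * h := by
  rw [hfac, primPart_mul (hfac ▸ hP), hh.isPrimitive.primPart_eq]

/-! ### The numerical estimate -/

/-- With `e ^ (10 N) ≤ H` and `κ ^ (20 t s) ≤ H`, the factorial and the powers of `2` and `κ` cost at
most `H ^ (2 N)` altogether, beside the main factor `H ^ (2 N)`. -/
theorem factorial_mul_pow_mul_pow_le {s t p n N : ℕ} {H κ c : ℝ} (hN : 1 ≤ N) (hn : n ≤ N)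
    (hK : s * t + p ≤ 2 * N) (hκ : 1 ≤ κ) (hc : 0 ≤ c) (hlog : (N : ℝ) ≤ 1 / 10 * Real.log H)
    (hH : κ ^ (20 * t * s) ≤ H) :
    ((s * t + p).factorial : ℝ) * ((c * κ ^ (14 * N)) ^ (s * t) * (8 ^ n * H) ^ p) ≤
      H ^ (5 * N) * c ^ (s * t) := by
  have hH1 : 1 ≤ H := (one_le_pow₀ hκ).trans hH
  have h2N : (2 : ℝ) ^ (8 * N) ≤ H := by
    calc (2 : ℝ) ^ (8 * N) ≤ Real.exp 1 ^ (8 * N) := by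
          gcongr
          have := Real.add_one_le_exp (1 : ℝ)
          linarith
      _ = Real.exp (8 * N) := by rw [← Real.exp_nat_mul]; congr 1; push_cast; ring
      _ ≤ Real.exp (Real.log H) := by
          apply Real.exp_le_exp.2
          have : (0 : ℝ) ≤ N := Nat.cast_nonneg _
          linarith
      _ = H := Real.exp_log (by linarith)
  have hfact : ((s * t + p).factorial : ℝ) ≤ 2 ^ (N * (2 * N)) := by
    have h1 : (s * t + p).factorial ≤ (2 * N) ^ (2 * N) :=
      (Nat.factorial_le hK).trans (Nat.factorial_le_pow _)
    have h2 : 2 * N ≤ 2 ^ N := by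
      have : N - 1 < 2 ^ (N - 1) := Nat.lt_two_pow_self
      have h3 : 2 ^ N = 2 * 2 ^ (N - 1) := by rw [← pow_succ']; congr 1; omega
      omega
    have h3 := h1.trans (Nat.pow_le_pow_left h2 (2 * N))
    rw [← pow_mul] at h3
    exact_mod_cast h3
  have h8 : (8 ^ n * H) ^ p ≤ 2 ^ (3 * N * (2 * N)) * H ^ (2 * N) := by
    have h1 : (8 : ℝ) ^ n ≤ 2 ^ (3 * N) := by
      rw [pow_mul]
      calc (8 : ℝ) ^ n ≤ 8 ^ N := pow_le_pow_right₀ (by norm_num) hn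
        _ = (2 ^ 3) ^ N := by norm_num
    calc (8 ^ n * H) ^ p ≤ (2 ^ (3 * N) * H) ^ p := by gcongr
      _ ≤ (2 ^ (3 * N) * H) ^ (2 * N) :=
          pow_le_pow_right₀ (one_le_mul_of_one_le_of_one_le (one_le_pow₀ (by norm_num)) hH1)
            (by omega)
      _ = 2 ^ (3 * N * (2 * N)) * H ^ (2 * N) := by rw [mul_pow, ← pow_mul]
  have hκp : (κ ^ (14 * N)) ^ (s * t) ≤ H ^ N := by
    calc (κ ^ (14 * N)) ^ (s * t) = κ ^ (14 * N * (s * t)) := by rw [← pow_mul]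
      _ ≤ κ ^ (20 * t * s * N) := by
          apply pow_le_pow_right₀ hκ
          nlinarith [Nat.zero_le (N * (s * t))]
      _ = (κ ^ (20 * t * s)) ^ N := by rw [pow_mul]
      _ ≤ H ^ N := by gcongr
  calc ((s * t + p).factorial : ℝ) * ((c * κ ^ (14 * N)) ^ (s * t) * (8 ^ n * H) ^ p)
      ≤ 2 ^ (N * (2 * N)) * ((c ^ (s * t) * H ^ N) * (2 ^ (3 * N * (2 * N)) * H ^ (2 * N))) := by
        rw [mul_pow]
        gcongr
    _ = (2 ^ (8 * N)) ^ N * H ^ (3 * N) * c ^ (s * t) := by ring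
    _ ≤ H ^ N * H ^ (3 * N) * c ^ (s * t) := by gcongr
    _ = H ^ (4 * N) * c ^ (s * t) := by rw [← pow_add]; congr 2; ring
    _ ≤ H ^ (5 * N) * c ^ (s * t) := by
        gcongr
        · omega

/-! ### The main inequality -/

/-- The inequality to be proved, raised to the power `t` and for polynomials freed from their
contents: `p = g * X ^ r * Φ ^ t` has divided derivatives at most `δ` at the `ξ ^ a`, and `Q` is a
common divisor of the polynomials `g^{[j]}(X ^ a)`, divisible by all the primitive ones. -/
theorem prod_norm_aeval_pow_mul_bigDelta_le {M n t : ℕ} {H δ η : ℝ} (ht : 1 ≤ t) (htn : t ≤ n)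
    {A : Finset ℕ} (hA : A.Nonempty) (hAM : A ⊆ Finset.Icc 1 M)
    {E : Finset ℂ} (hE : E.Nonempty) (hE0 : ∀ ξ ∈ E, ξ ≠ 0)
    {p g Φ : ℤ[X]} {r : ℕ} (hp : p ≠ 0) (hdeg : p.natDegree ≤ n) (hH : ∀ i, ‖p.coeff i‖ ≤ H)
    (hfac : p = g * X ^ r * Φ ^ t) (hΦ : IsCyclotomicPoly Φ)
    (hcard : t * E.card ≤ M * n)
    (hlog : ((M * n : ℕ) : ℝ) ≤ 1 / 10 * Real.log H)
    (hX : (2 + constE E hE) ^ (20 * t * E.card) ≤ H)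
    (hδ : ∀ a ∈ A, ∀ ξ ∈ E, ∀ k < 2 * t - 1, ‖aeval (ξ ^ a) (hasseDeriv k p)‖ ≤ δ)
    (hη : ∀ a ∈ A, ∀ ξ ∈ E, η ≤ ‖aeval (ξ ^ a) Φ‖) (hη0 : 0 < η) (hη1 : η ≤ 1)
    {Q : ℤ[X]} (hQdvd : ∀ a ∈ A, ∀ j < t, Q ∣ (hasseDeriv j g).comp (X ^ a))
    (hQ : ∀ D : ℤ[X], D.IsPrimitive →
      (∀ a ∈ A, ∀ j < t, D ∣ (hasseDeriv j g).comp (X ^ a)) → D ∣ Q) :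
    (∏ ξ ∈ E, ‖aeval ξ Q‖) ^ t * bigDelta E ^ (t * t) ≤
      H ^ (5 * (M * n)) * (δ / η ^ (3 * t)) ^ (E.card * t) := by
  obtain ⟨a₀, ha₀⟩ := hA
  obtain ⟨ξ₀, hξ₀⟩ := id hE
  have hAmem : ∀ a ∈ A, 1 ≤ a ∧ a ≤ M := fun a ha => Finset.mem_Icc.1 (hAM ha)
  have hδ0 : 0 ≤ δ := (norm_nonneg _).trans (hδ a₀ ha₀ ξ₀ hξ₀ 0 (by omega))
  set N := M * n with hN
  have hM1 : 1 ≤ M := (hAmem a₀ ha₀).1.trans (hAmem a₀ ha₀).2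
  have hnN : n ≤ N := by rw [hN]; nlinarith
  have hN1 : 1 ≤ N := by omega
  have hg0 : g ≠ 0 := by rintro rfl; simp [hfac] at hp
  have hΦ0 : Φ ≠ 0 := hΦ.1.ne_zero
  have hdeg' : g.natDegree + r + t * Φ.natDegree ≤ n := by
    rw [hfac, natDegree_mul (mul_ne_zero hg0 (pow_ne_zero _ X_ne_zero)) (pow_ne_zero _ hΦ0),
      natDegree_mul hg0 (pow_ne_zero _ X_ne_zero), natDegree_X_pow, natDegree_pow] at hdeg
    exact hdeg
  have hgn : g.natDegree ≤ n := by omega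
  set c := constE E hE with hc
  have hc1 : 1 ≤ c := one_le_constE hE hE0
  set κ := 2 + c with hκ
  have hκ3 : 3 ≤ κ := by linarith
  -- the data over `ℂ`
  set f := Int.castRingHom ℂ with hf
  have hfinj : Function.Injective f := RingHom.injective_int _
  have hnorm : ∀ (P : ℤ[X]) (i : ℕ), ‖(P.map f).coeff i‖ = ‖P.coeff i‖ := fun P i => by
    rw [coeff_map, hf, eq_intCast, Complex.norm_intCast, Int.norm_eq_abs]
  have hfacC : p.map f = g.map f * X ^ r * Φ.map f ^ t := by rw [hfac]; simp
  have hΦC : (Φ.map f).Monic := hΦ.1.map f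
  have hroots : ∀ ζ ∈ (Φ.map f).roots, ‖ζ‖ ≤ 1 := by
    intro ζ hζ
    have h1 : aeval ζ Φ = 0 := by
      rw [aeval_def, eval₂_eq_eval_map]
      exact (mem_roots'.1 hζ).2
    exact (hΦ.2 ζ h1).norm_eq_one.le
  -- the derivatives of the cofactor `g`
  have hgder : ∀ a ∈ A, ∀ ξ ∈ E, ∀ k < 2 * t - 1,
      ‖(taylor (ξ ^ a) (g.map f)).coeff k‖ ≤ δ / η ^ (3 * t) * κ ^ (9 * N) := by
    intro a ha ξ hξ
    have ha' := hAmem a ha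
    have hξ' : 0 < ‖ξ‖ := norm_pos_iff.2 (hE0 ξ hξ)
    refine norm_coeff_taylor_cofactor_le hfacC hΦC hroots ?_ ?_ hη0 hη1 hδ0 (by linarith) ?_ ?_
      ha'.1 ha'.2 ht htn ?_
    · intro k hk
      rw [coeff_taylor_map_intCast]
      exact hδ a ha ξ hξ k hk
    · rw [← eval₂_eq_eval_map]
      exact hη a ha ξ hξ
    · refine le_trans ?_ (two_add_pow_le (by linarith) ha'.1)
      rw [norm_pow]
      gcongr
      exact norm_le_constE hE hξ
    · rw [norm_pow, ← mul_pow]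
      refine one_le_pow₀ ?_
      have h1 := inv_norm_le_constE hE hξ
      rw [inv_le_iff_one_le_mul₀ hξ'] at h1
      nlinarith
    · rw [natDegree_map_eq_of_injective hfinj]; omega
  -- the coefficients of `g`
  have hgcoeff : ∀ i, ‖g.coeff i‖ ≤ 4 ^ n * H := by
    intro i
    rw [← hnorm]
    refine norm_coeff_cofactor_le (p := p.map f) (h := X ^ r * Φ.map f ^ t)
      (by rw [hfacC, mul_assoc]) ((monic_X_pow r).mul (hΦC.pow t)) ?_
      ((Polynomial.map_ne_zero_iff hfinj).2 hp) (natDegree_map_le.trans hdeg)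
      (fun i => by rw [hnorm]; exact hH i) i
    intro ζ hζ
    have h1 : ζ ^ r * (Φ.map f).eval ζ ^ t = 0 := by
      simpa using (mem_roots'.1 hζ).2
    rcases mul_eq_zero.1 h1 with h | h
    · rw [eq_zero_of_pow_eq_zero h, norm_zero]; exact zero_le_one
    · exact hroots ζ ((mem_roots hΦC.ne_zero).2 (pow_eq_zero_iff (by omega) |>.1 h))
  -- the independent multiples of `Q`
  let F : A × Fin t → ℤ[X] := fun q => (hasseDeriv q.2 g).comp (X ^ (q.1 : ℕ))
  have hFN : ∀ q, (F q).natDegree ≤ N := by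
    intro q
    have h1 := hAmem q.1 q.1.2
    rw [natDegree_comp, natDegree_X_pow, mul_comm]
    exact Nat.mul_le_mul h1.2 (((natDegree_hasseDeriv_le g q.2).trans (Nat.sub_le _ _)).trans hgn)
  have hF0 : ∃ q, F q ≠ 0 := by
    refine ⟨(⟨a₀, ha₀⟩, ⟨0, ht⟩), ?_⟩
    change (hasseDeriv 0 g).comp (X ^ a₀) ≠ 0
    rw [hasseDeriv_zero', ← expand_eq_comp_X_pow]
    exact (expand_ne_zero (hAmem a₀ ha₀).1).2 hg0
  have hFQ : ∀ q, Q ∣ F q := fun q => hQdvd _ q.1.2 _ q.2.2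
  have hQ0 : Q ≠ 0 := by
    obtain ⟨q, hq⟩ := hF0
    rintro rfl
    exact hq (zero_dvd_iff.1 (hFQ q))
  have hQN : Q.natDegree ≤ N := by
    obtain ⟨q, hq⟩ := hF0
    exact (natDegree_le_of_dvd (hFQ q) hq).trans (hFN q)
  have hG := exists_shifts_det_ne_zero F N Q hFN hF0 hFQ
    fun D hD hDF => hQ D hD fun a ha j hj => hDF (⟨a, ha⟩, ⟨j, hj⟩)
  set s := E.card with hs
  have hsN : s * t ≤ N := by rw [mul_comm]; exact hcard
  obtain ⟨u, hu⟩ : ∃ u, 2 * N - Q.natDegree = s * t + u := Nat.exists_eq_add_of_le (by omega)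
  rw [hu] at hG
  obtain ⟨G, hG, hdet⟩ := hG
  -- the nodes
  let x : Fin s → ℂ := fun b => (E.equivFin.symm b : ℂ)
  have hxinj : Function.Injective x := Subtype.val_injective.comp E.equivFin.symm.injective
  have hxE : ∀ b, x b ∈ E := fun b => (E.equivFin.symm b).2
  have hEx : E = Finset.univ.map ⟨x, hxinj⟩ := by
    ext ξ
    simp only [Finset.mem_map, Finset.mem_univ, true_and, Function.Embedding.coeFn_mk]
    refine ⟨fun h => ⟨E.equivFin ⟨ξ, h⟩, by simp [x]⟩, ?_⟩
    rintro ⟨b, rfl⟩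
    exact hxE b
  have hprod : ∏ ξ ∈ E, ‖aeval ξ Q‖ = ∏ b, ‖aeval (x b) Q‖ := by
    conv_lhs => rw [hEx]
    rw [Finset.prod_map]; rfl
  rw [hprod, bigDelta_eq_prod_Iio E x hxinj hEx]
  refine (prod_norm_eval_pow_mul_le x Q hQ0 G (fun k => (hG k).choose_spec.choose_spec.2.2) hdet
    (δ / η ^ (3 * t) * κ ^ (14 * N)) (8 ^ n * H) ?_ ?_).trans ?_
  · intro b k j hj
    obtain ⟨q, i, hi, hqi, -⟩ := hG k
    have hq := hAmem q.1 q.1.2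
    rw [hqi, ← coeff_taylor_map_intCast]
    have hmap : (X ^ i * F q).map (Int.castRingHom ℂ) =
        X ^ i * (hasseDeriv q.2 (g.map f)).comp (X ^ (q.1 : ℕ)) := by
      simp only [F]
      rw [hasseDeriv_map_intCast]
      simp [Polynomial.map_comp]
    rw [hmap]
    refine (norm_coeff_taylor_X_pow_mul_comp_le (N := N) (t := t)
      (hgder _ q.1.2 _ (hxE b)) hκ3 ?_ hi q.2.2 hj (Nat.mul_le_mul hq.2 htn) hq.1).trans (le_of_eq ?_)
    · have := norm_le_constE hE (hxE b)
      linarith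
    · rw [mul_assoc, ← pow_add]; congr 2; ring
  · intro i k
    obtain ⟨q, l, -, hqi, -⟩ := hG k
    rw [hqi]
    refine (norm_coeff_X_pow_mul_comp_le hgn hgcoeff (hAmem q.1 q.1.2).1 i).trans (le_of_eq ?_)
    rw [← mul_assoc, ← mul_pow]; norm_num
  · exact factorial_mul_pow_mul_pow_le hN1 hnN (by omega) (by linarith) (by positivity) hlog hX

theorem proposition3p1 (M n t : ℕ) (X : ℝ) (hM : 1 ≤ M) (ht : 1 ≤ t) (htn : t ≤ n)
    (A : Finset ℕ) (hA : A.Nonempty) (hAM : A ⊆ Finset.Icc 1 M)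
    (E : Finset ℂ) (hE : E.Nonempty) (hE0 : ∀ ξ ∈ E, ξ ≠ 0)
    (hEtor : ∀ ξ ∈ E, ¬ IsOfFinOrder ξ)
    (P P₀ Φ : ℤ[X]) (r : ℕ) (hP : P ≠ 0) (hdeg : P.natDegree ≤ n) (hheight : intHeight P ≤ X)
    (hfac : P = P₀ * Polynomial.X ^ r * Φ ^ t) (hΦ : IsCyclotomicPoly Φ)
    (hcard : t * E.card ≤ M * n)
    (hlog : (M : ℝ) * (n : ℝ) ≤ 1 / 10 * Real.log X)
    (hX : (2 + constE E hE) ^ (20 * t * E.card) ≤ X)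
    (Q : ℤ[X])
    (hQ : IsPolyGCD {F : ℤ[X] | ∃ a ∈ A, ∃ j < t, F = (hasseDeriv j P₀).comp (Polynomial.X ^ a)} Q) :
    ∏ ξ ∈ E, (‖aeval ξ Q‖ / (Q.content : ℝ)) ≤
      X ^ (5 * (M : ℝ) * (n : ℝ) / (t : ℝ)) * bigDelta E ^ (-(t : ℤ)) *
        (deltaP P t ht A hA E hE / min 1 (deltaPhi Φ A hA E hE) ^ (3 * t)) ^ E.card := by
  have hA0 : ∀ a ∈ A, 0 < a := fun a ha => (Finset.mem_Icc.1 (hAM ha)).1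
  set δ := deltaP P t ht A hA E hE with hδdef
  set η := min 1 (deltaPhi Φ A hA E hE) with hηdef
  have hη0 : 0 < η := lt_min one_pos (deltaPhi_pos hΦ hA hA0 hE hEtor)
  have hX1 : 1 ≤ X := by
    refine le_trans (one_le_pow₀ ?_) hX
    have := one_le_constE hE hE0
    linarith
  have hP₀ : P₀ ≠ 0 := by rintro rfl; simp [hfac] at hP
  -- `P₀^{[j]}(X ^ a)` is the content of `P₀` times the same polynomial made from `primPart P₀`
  have hcontent : ∀ (a j : ℕ), (hasseDeriv j P₀).comp (Polynomial.X ^ a) =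
      C P₀.content * (hasseDeriv j P₀.primPart).comp (Polynomial.X ^ a) := by
    intro a j
    conv_lhs => rw [P₀.eq_C_content_mul_primPart, ← smul_eq_C_mul, map_smul, smul_comp,
      smul_eq_C_mul]
  have hcP₀ : C P₀.content ≠ 0 := C_ne_zero.2 (mt content_eq_zero_iff.1 hP₀)
  have hQ0 : Q ≠ 0 := by
    rintro rfl
    obtain ⟨a, ha⟩ := id hA
    have h1 := zero_dvd_iff.1 (hQ.1 _ ⟨a, ha, 0, ht, rfl⟩)
    rw [hasseDeriv_zero', ← expand_eq_comp_X_pow] at h1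
    exact (expand_ne_zero (hA0 a ha)).2 hP₀ h1
  have key := prod_norm_aeval_pow_mul_bigDelta_le (M := M) (H := X) (δ := δ) (η := η)
    (p := P.primPart) (g := P₀.primPart) (Φ := Φ) (r := r) (Q := Q.primPart) ht htn hA hAM hE hE0
    P.primPart_ne_zero (by rwa [natDegree_primPart])
    (fun i => (norm_coeff_primPart_le_intHeight hP i).trans hheight)
    (by
      rw [mul_assoc] at hfac ⊢
      exact primPart_eq_mul hP hfac ((monic_X_pow r).mul (hΦ.1.pow t)))
    hΦ hcard (by exact_mod_cast hlog) hX
    (by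
      intro a ha ξ hξ k hk
      refine le_trans ?_ (norm_hasseDeriv_le_deltaP ht hA hE ha hξ hk)
      have h1 : aeval (ξ ^ a) (hasseDeriv k P) =
          (P.content : ℂ) * aeval (ξ ^ a) (hasseDeriv k P.primPart) := by
        conv_lhs => rw [P.eq_C_content_mul_primPart, ← smul_eq_C_mul, map_smul]
        simp
      rw [h1, norm_mul, Complex.norm_intCast]
      exact le_mul_of_one_le_left (norm_nonneg _) ((one_le_content hP).trans (le_abs_self _)))
    (fun a ha ξ hξ => (min_le_right _ _).trans (deltaPhi_le hA hE ha hξ))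
    hη0 (min_le_left _ _)
    (by
      intro a ha j hj
      have h1 : Q.primPart ∣ C P₀.content * (hasseDeriv j P₀.primPart).comp (Polynomial.X ^ a) := by
        rw [← hcontent]
        exact Q.primPart_dvd.trans (hQ.1 _ ⟨a, ha, j, hj, rfl⟩)
      rcases eq_or_ne ((hasseDeriv j P₀.primPart).comp (Polynomial.X ^ a)) 0 with h0 | h0
      · rw [h0]; exact dvd_zero _
      · rw [Q.isPrimitive_primPart.dvd_primPart_iff_dvd (mul_ne_zero hcP₀ h0) |>.symm,
          primPart_mul (mul_ne_zero hcP₀ h0)] at h1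
        rw [← Q.isPrimitive_primPart.dvd_primPart_iff_dvd h0]
        exact (isUnit_primPart_C _).dvd_mul_left.1 h1)
    (by
      intro D hD hDF
      refine (hD.dvd_primPart_iff_dvd hQ0).2 (hQ.2 D ?_)
      rintro _ ⟨a, ha, j, hj, rfl⟩
      rw [hcontent]
      exact (hDF a ha j hj).mul_left _)
  -- passing to primitive parts divides `|Q(ξ)|` by the content of `Q`
  have hprod : ∏ ξ ∈ E, (‖aeval ξ Q‖ / (Q.content : ℝ)) = ∏ ξ ∈ E, ‖aeval ξ Q.primPart‖ := by
    refine Finset.prod_congr rfl fun ξ _ => ?_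
    have h1 := one_le_content hQ0
    rw [aeval_eq_content_mul_aeval_primPart, norm_mul, Complex.norm_intCast,
      abs_of_nonneg (by linarith), mul_div_cancel_left₀ _ (by linarith)]
  rw [hprod]
  have hΔ := bigDelta_pos E
  have hδ0 : 0 ≤ δ := by
    obtain ⟨a, ha⟩ := id hA
    obtain ⟨ξ, hξ⟩ := id hE
    exact (norm_nonneg _).trans
      (norm_hasseDeriv_le_deltaP ht hA hE ha hξ (k := 0) (by omega))
  have ht0 : (t : ℝ) ≠ 0 := by exact_mod_cast (by omega : t ≠ 0)
  -- compare the `t`-th powers of both sides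
  refine le_of_pow_le_pow_left₀ (n := t) (by omega) (by positivity) ?_
  have hroot : (X ^ (5 * (M : ℝ) * (n : ℝ) / (t : ℝ))) ^ t = X ^ (5 * (M * n)) := by
    rw [← Real.rpow_natCast, ← Real.rpow_mul (by linarith), div_mul_cancel₀ _ ht0,
      ← Real.rpow_natCast]
    congr 1
    push_cast
    ring
  rw [mul_pow, mul_pow, hroot, zpow_neg, zpow_natCast, inv_pow, ← pow_mul, ← pow_mul,
    mul_right_comm, ← div_eq_mul_inv, le_div_iff₀ (by positivity)]
  exact key
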